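/- **Conventions.** For a metric space $X$, a family $\mathcal U$ of subsets of $X$ is *uniformly bounded* if the diameters of its members are bounded by a common constant; these families form the (metric) large scale structure of $X$. In general a large scale structure on a set is a nonempty set of families of subsets (called uniformly bounded) which contains $\mathcal B_2$ whenever it contains $\mathcal B_1$ and every member of $\mathcal B_2$ with more than one point lies in a member of $\mathcal B_1$, and which contains the family of stars $\mathrm{st}(\mathcal B_1,\mathcal B_2)=\{\bigcup\{U\in\mathcal B_2: U\cap B\neq\emptyset\}: B\in\mathcal B_1\}$ whenever it contains $\mathcal B_1$ and $\mathcal B_2$. A subset is bounded if it is a member of a uniformly bounded family. A map is *ls-continuous* if it sends uniformly bounded families to uniformly bounded families; two maps $f,g$ into a large scale space are *close* if $\{\{f(x),g(x)\}\}_x$ is uniformly bounded; an ls-continuous map is a *coarse equivalence* if it has an ls-continuous inverse up to closeness. A *coarse map* is an ls-continuous map such that the inverse image of every bounded set is bounded. **Coarsely monotone maps.** Let $f:X\to Y$ be ls-continuous. For uniformly bounded families $\mathcal U$ in $X$ and $\mathcal V$ in $Y$, let $c(\mathcal U,f,\mathcal V)$ be the family of all $\mathcal U$-components of the sets $f^{-1}(V)$,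 $V\in\mathcal V$ (two points of a set $W$ lie in the same $\mathcal U$-component of $W$ if they are joined by a finite chain in $W$ whose consecutive points lie in a common member of $\mathcal U$). The *light structure* on $X$ with respect to $f$ is the large scale structure consisting of all families $\mathcal B$ for which there are such $\mathcal U,\mathcal V$ so that every member of $\mathcal B$ with more than one point is contained in a member of $c(\mathcal U,f,\mathcal V)$. Let $X_f$ be the set $X$ with this structure. The map $f$ is *coarsely monotone* if $f$, regarded as a map $X_f\to Y$, is a coarse equivalence. **Higson corona.** For a metric space $X$, let $B_h(X)$ be the $C^*$-algebra (with the supremum norm) of all bounded, not necessarily continuous, functions $g:X\to\mathbb C$ that are slowly oscillating, i.e. for all $R,\varepsilon>0$ there is a bounded set $B\subseteq X$ such that $|g(x)-g(x')|\le\varepsilon$ for all $x,x'\in X\setminus B$ with $d(x,x')\le R$. Let $B_0(X)$ be the ideal of those $g\in B_h(X)$ that tend to zero at infinity, i.e. outside bounded sets. The Higson corona $\nu X$ of a proper metric space $X$ is the compact Hausdorff space Gelfand dual to $B_h(X)/B_0(X)$, that is, its space of characters with the weak-$*$ topology. A coarse map $f:X\to Y$ induces $f^*:B_h(Y)/B_0(Y)\to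 B_h(X)/B_0(X)$, $[g]\mapsto[g\circ f]$, and hence a continuous map $\nu f:\nu X\to\nu Y$, $\varphi\mapsto\varphi\circ f^*$. **Theorem.** Let $X$ and $Y$ be proper metric spaces, $X$ nonempty, and let $f:X\to Y$ be a coarse map. Then $f$ is coarsely monotone if and only if the induced continuous map $\nu f:\nu X\to\nu Y$ is (classically) monotone, i.e. surjective with all fibres connected. -/

import Mathlib

open scoped ENNReal Topology

noncomputable section

namespace Coarse

universe u v

/-! ## Large scale spaces -/

/-- The star of `B` with respect to the family `𝒰`: the union of the elements of `𝒰` meeting `B`. -/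
def starSet {X : Type u} (B : Set X) (𝒰 : Set (Set X)) : Set X :=
  ⋃₀ {U | U ∈ 𝒰 ∧ (U ∩ B).Nonempty}

/-- The family of stars of the elements of `ℬ` with respect to `𝒰`. -/
def starFamily {X : Type u} (ℬ 𝒰 : Set (Set X)) : Set (Set X) :=
  (fun B => starSet B 𝒰) '' ℬ

/-- `ℬ` refines `𝒰`, where elements of `ℬ` having at most one point are disregarded: every element
of `ℬ` consisting of more than one point is contained in some element of `𝒰`. -/
def EssRefines {X : Type u} (ℬ 𝒰 : Set (Set X)) : Prop :=
  ∀ B ∈ ℬ, B.Nontrivial → ∃ U ∈ 𝒰, B ⊆ U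

/-- A large scale structure on `X`. -/
structure LargeScaleStructure (X : Type u) where
  /-- the uniformly bounded families -/
  uniformlyBounded : Set (Set (Set X))
  nonempty' : uniformlyBounded.Nonempty
  of_refines' : ∀ ℬ₁ ∈ uniformlyBounded, ∀ ℬ₂, EssRefines ℬ₂ ℬ₁ → ℬ₂ ∈ uniformlyBounded
  star_mem' : ∀ ℬ₁ ∈ uniformlyBounded, ∀ ℬ₂ ∈ uniformlyBounded,
    starFamily ℬ₁ ℬ₂ ∈ uniformlyBounded

/-- A subset of a large scale space is bounded if it belongs to some uniformly bounded family. -/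
def LargeScaleStructure.Bounded {X : Type u} (L : LargeScaleStructure X) (B : Set X) : Prop :=
  ∃ 𝒰 ∈ L.uniformlyBounded, B ∈ 𝒰

/-- The families of subsets of a metric space whose elements have diameter at most a common
constant form a large scale structure. -/
def metricStructure (X : Type u) [MetricSpace X] : LargeScaleStructure X where
  uniformlyBounded := {𝒰 | ∃ M : ℝ, 0 < M ∧ ∀ U ∈ 𝒰, ∀ x ∈ U, ∀ y ∈ U, dist x y ≤ M}
  nonempty' := ⟨∅, 1, one_pos, by simp⟩
  of_refines' := by
    rintro ℬ₁ ⟨M, hM, h⟩ ℬ₂ href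
    refine ⟨M, hM, fun B hB x hx y hy => ?_⟩
    by_cases hxy : x = y
    · subst hxy
      simpa using hM.le
    · obtain ⟨U, hU, hBU⟩ := href B hB ⟨x, hx, y, hy, hxy⟩
      exact h U hU x (hBU hx) y (hBU hy)
  star_mem' := by
    rintro ℬ₁ ⟨M₁, hM₁, h₁⟩ ℬ₂ ⟨M₂, hM₂, h₂⟩
    refine ⟨M₂ + M₁ + M₂, by positivity, ?_⟩
    rintro _ ⟨B, hB, rfl⟩ x ⟨U, ⟨hU, p, hpU, hpB⟩, hxU⟩ y ⟨V, ⟨hV, q, hqV, hqB⟩, hyV⟩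
    have e₁ := h₂ U hU x hxU p hpU
    have e₂ := h₁ B hB p hpB q hqB
    have e₃ := h₂ V hV q hqV y hyV
    have e₄ := dist_triangle4 x p q y
    linarith

/-- A map is large scale continuous if it sends uniformly bounded families to uniformly bounded
families. -/
def LSContinuous {X : Type u} {Y : Type v} (LX : LargeScaleStructure X)
    (LY : LargeScaleStructure Y) (f : X → Y) : Prop :=
  ∀ 𝒰 ∈ LX.uniformlyBounded, (fun U => f '' U) '' 𝒰 ∈ LY.uniformlyBounded

/-- A coarse map: a large scale continuous map for which preimages of bounded sets are bounded. -/
def IsCoarseMap {X : Type u} {Y : Type v} (LX : LargeScaleStructure X)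
    (LY : LargeScaleStructure Y) (f : X → Y) : Prop :=
  LSContinuous LX LY f ∧ ∀ B, LY.Bounded B → LX.Bounded (f ⁻¹' B)

/-- Two maps into a large scale space are close if `{{f x, g x} | x}` is uniformly bounded. -/
def Close {X : Type u} {Y : Type v} (LY : LargeScaleStructure Y) (f g : X → Y) : Prop :=
  Set.range (fun x => ({f x, g x} : Set Y)) ∈ LY.uniformlyBounded

/-- Coarse equivalences: the large scale continuous maps with a large scale continuous inverse up
to closeness. -/
def IsCoarseEquivalence {X : Type u} {Y : Type v} (LX : LargeScaleStructure X)
    (LY : LargeScaleStructure Y) (f : X → Y) : Prop :=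
  LSContinuous LX LY f ∧ ∃ g : Y → X, LSContinuous LY LX g ∧
    Close LY (f ∘ g) id ∧ Close LX (g ∘ f) id

/-! ## The light structure and coarsely monotone maps -/

/-- One step of a `𝒰`-chain inside the set `W`. -/
def ChainStep {X : Type u} (𝒰 : Set (Set X)) (W : Set X) (x y : X) : Prop :=
  x ∈ W ∧ y ∈ W ∧ ∃ U ∈ 𝒰, x ∈ U ∧ y ∈ U

/-- The `𝒰`-component of the point `x ∈ W` in the set `W`: all endpoints of finite `𝒰`-chains
inside `W` that start at `x`. -/
def component {X : Type u} (𝒰 : Set (Set X)) (W : Set X) (x : X) : Set X :=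
  {y | Relation.ReflTransGen (ChainStep 𝒰 W) x y}

/-- The family `c(𝒰, f, 𝒱)` of all `𝒰`-components of elements of `f⁻¹(𝒱)`. -/
def componentFamily {X : Type u} {Y : Type v} (𝒰 : Set (Set X)) (f : X → Y) (𝒱 : Set (Set Y)) :
    Set (Set X) :=
  {C | ∃ V ∈ 𝒱, ∃ x ∈ f ⁻¹' V, C = component 𝒰 (f ⁻¹' V) x}

theorem ChainStep.symm {X : Type u} {𝒰 : Set (Set X)} {W : Set X} {x y : X}
    (h : ChainStep 𝒰 W x y) : ChainStep 𝒰 W y x := by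
  obtain ⟨hx, hy, U, hU, hxU, hyU⟩ := h
  exact ⟨hy, hx, U, hU, hyU, hxU⟩

theorem component_mono {X : Type u} {𝒰 𝒰' : Set (Set X)} {W W' : Set X} (hW : W ⊆ W')
    (h𝒰 : ∀ U ∈ 𝒰, ∃ U' ∈ 𝒰', U ⊆ U') (x : X) : component 𝒰 W x ⊆ component 𝒰' W' x := by
  intro y hy
  refine Relation.ReflTransGen.mono (r := ChainStep 𝒰 W) ?_ _ _ hy
  rintro a b ⟨ha, hb, U, hU, haU, hbU⟩
  obtain ⟨U', hU', hUU'⟩ := h𝒰 U hU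
  exact ⟨hW ha, hW hb, U', hU', hUU' haU, hUU' hbU⟩

theorem component_symm {X : Type u} {𝒰 : Set (Set X)} {W : Set X} {x y : X}
    (h : y ∈ component 𝒰 W x) : x ∈ component 𝒰 W y := by
  have : Std.Symm (ChainStep 𝒰 W) := ⟨fun _ _ => ChainStep.symm⟩
  exact Relation.ReflTransGen.stdSymm.symm _ _ h

theorem component_trans {X : Type u} {𝒰 : Set (Set X)} {W : Set X} {x y z : X}
    (h : y ∈ component 𝒰 W x) (h' : z ∈ component 𝒰 W y) : z ∈ component 𝒰 W x :=
  Relation.ReflTransGen.trans h h'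

theorem component_subset {X : Type u} {𝒰 : Set (Set X)} {W : Set X} {x : X} (hx : x ∈ W) :
    component 𝒰 W x ⊆ W := by
  intro y hy
  cases hy with
  | refl => exact hx
  | tail _ h => exact h.2.1

/-- Any two uniformly bounded families are refined by one uniformly bounded cover. -/
theorem LargeScaleStructure.exists_common {X : Type u} (L : LargeScaleStructure X)
    {𝒰 𝒱 : Set (Set X)} (h𝒰 : 𝒰 ∈ L.uniformlyBounded) (h𝒱 : 𝒱 ∈ L.uniformlyBounded) :
    ∃ 𝒲 ∈ L.uniformlyBounded, (∀ x, ∃ W ∈ 𝒲, x ∈ W) ∧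
      (∀ U ∈ 𝒰, ∃ W ∈ 𝒲, U ⊆ W) ∧ (∀ V ∈ 𝒱, V.Nonempty → ∃ W ∈ 𝒲, V ⊆ W) := by
  have key : ∀ 𝒜 ∈ L.uniformlyBounded, 𝒜 ∪ Set.range (fun x : X => ({x} : Set X)) ∈
      L.uniformlyBounded := by
    intro 𝒜 h𝒜
    refine L.of_refines' 𝒜 h𝒜 _ ?_
    rintro B (hB | ⟨x, rfl⟩) hn
    · exact ⟨B, hB, subset_rfl⟩
    · exact absurd hn Set.not_nontrivial_singleton
  refine ⟨_, L.star_mem' _ (key 𝒰 h𝒰) _ (key 𝒱 h𝒱), ?_, ?_, ?_⟩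
  · intro x
    exact ⟨_, ⟨{x}, Or.inr ⟨x, rfl⟩, rfl⟩, {x}, ⟨Or.inr ⟨x, rfl⟩, x, rfl, rfl⟩, rfl⟩
  · intro U hU
    refine ⟨_, ⟨U, Or.inl hU, rfl⟩, fun x hx => ⟨{x}, ⟨Or.inr ⟨x, rfl⟩, x, rfl, hx⟩, rfl⟩⟩
  · rintro V hV ⟨p, hp⟩
    refine ⟨_, ⟨{p}, Or.inr ⟨p, rfl⟩, rfl⟩, fun x hx => ⟨V, ⟨Or.inl hV, p, hp, rfl⟩, hx⟩⟩

/-- The light structure on `X` with respect to `f`: the closure under refinement of the set of all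
families `c(𝒰, f, 𝒱)` with `𝒰`, `𝒱` uniformly bounded. -/
def lightStructure {X : Type u} {Y : Type v} (LX : LargeScaleStructure X)
    (LY : LargeScaleStructure Y) (f : X → Y) : LargeScaleStructure X where
  uniformlyBounded := {ℬ | ∃ 𝒰 ∈ LX.uniformlyBounded, ∃ 𝒱 ∈ LY.uniformlyBounded,
    EssRefines ℬ (componentFamily 𝒰 f 𝒱)}
  nonempty' := by
    obtain ⟨𝒰, h𝒰⟩ := LX.nonempty'
    obtain ⟨𝒱, h𝒱⟩ := LY.nonempty'
    exact ⟨∅, 𝒰, h𝒰, 𝒱, h𝒱, fun B hB => absurd hB (Set.notMem_empty B)⟩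
  of_refines' := by
    rintro ℬ₁ ⟨𝒰, h𝒰, 𝒱, h𝒱, h⟩ ℬ₂ href
    refine ⟨𝒰, h𝒰, 𝒱, h𝒱, fun B hB hn => ?_⟩
    obtain ⟨B', hB', hBB'⟩ := href B hB hn
    obtain ⟨C, hC, hB'C⟩ := h B' hB' (hn.mono hBB')
    exact ⟨C, hC, hBB'.trans hB'C⟩
  star_mem' := by
    rintro ℬ₁ ⟨𝒰₁, h𝒰₁, 𝒱₁, h𝒱₁, h₁⟩ ℬ₂ ⟨𝒰₂, h𝒰₂, 𝒱₂, h𝒱₂, h₂⟩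
    obtain ⟨𝒰, h𝒰, -, hr₁, hr₂⟩ := LX.exists_common h𝒰₁ h𝒰₂
    obtain ⟨𝒱, h𝒱, hcov, hs₁, hs₂⟩ := LY.exists_common h𝒱₁ h𝒱₂
    have hr₂' : ∀ {W : Set X} (x : X), component 𝒰₂ W x ⊆ component 𝒰 W x := by
      intro W x y hy
      refine Relation.ReflTransGen.mono (r := ChainStep 𝒰₂ W) ?_ _ _ hy
      rintro a b ⟨ha, hb, U, hU, haU, hbU⟩
      obtain ⟨U', hU', hUU'⟩ := hr₂ U hU ⟨a, haU⟩
      exact ⟨ha, hb, U', hU', hUU' haU, hUU' hbU⟩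
    refine ⟨𝒰, h𝒰, _, LY.star_mem' 𝒱 h𝒱 𝒱 h𝒱, ?_⟩
    rintro _ ⟨B, hB, rfl⟩ hn
    have hne : B.Nonempty := by
      obtain ⟨x, ⟨U, ⟨-, p, -, hp⟩, -⟩, -⟩ := hn
      exact ⟨p, hp⟩
    -- `B` lies in a component of the preimage of an element of `𝒱`
    obtain ⟨V, hV, x, hx, hBx⟩ : ∃ V ∈ 𝒱, ∃ x ∈ f ⁻¹' V, B ⊆ component 𝒰 (f ⁻¹' V) x := by
      by_cases hBn : B.Nontrivial
      · obtain ⟨_, ⟨V, hV, x, hx, rfl⟩, hBx⟩ := h₁ B hB hBn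
        obtain ⟨V', hV', hVV'⟩ := hs₁ V hV
        exact ⟨V', hV', x, hVV' hx,
          hBx.trans (component_mono (Set.preimage_mono hVV') hr₁ x)⟩
      · obtain ⟨p, hp⟩ := hne
        obtain ⟨V, hV, hpV⟩ := hcov (f p)
        refine ⟨V, hV, p, hpV, fun q hq => ?_⟩
        have : q = p := by
          by_contra hqp
          exact hBn ⟨q, hq, p, hp, hqp⟩
        subst this
        exact Relation.ReflTransGen.refl
    have hVst : V ⊆ starSet V 𝒱 := fun y hy => ⟨V, ⟨hV, y, hy, hy⟩, hy⟩
    have hid : ∀ U ∈ 𝒰, ∃ U' ∈ 𝒰, U ⊆ U' := fun U hU => ⟨U, hU, subset_rfl⟩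
    have hB' : B ⊆ component 𝒰 (f ⁻¹' starSet V 𝒱) x :=
      hBx.trans (component_mono (Set.preimage_mono hVst) hid x)
    refine ⟨_, ⟨starSet V 𝒱, ⟨V, hV, rfl⟩, x, hVst hx, rfl⟩, ?_⟩
    rintro y ⟨B₂, ⟨hB₂, z, hz₂, hz⟩, hy⟩
    by_cases hyz : y = z
    · rw [hyz]
      exact hB' hz
    · obtain ⟨_, ⟨V₂, hV₂, x₂, hx₂, rfl⟩, hB₂x⟩ := h₂ B₂ hB₂ ⟨y, hy, z, hz₂, hyz⟩
      obtain ⟨V', hV', hVV'⟩ := hs₂ V₂ hV₂ ⟨_, hx₂⟩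
      have hzV : f z ∈ V := component_subset (W := f ⁻¹' V) hx (hBx hz)
      have hzV₂ : f z ∈ V₂ := component_subset (W := f ⁻¹' V₂) hx₂ (hB₂x hz₂)
      have hsub : V₂ ⊆ starSet V 𝒱 := fun w hw => ⟨V', ⟨hV', f z, hVV' hzV₂, hzV⟩, hVV' hw⟩
      have hm : component 𝒰₂ (f ⁻¹' V₂) x₂ ⊆ component 𝒰 (f ⁻¹' starSet V 𝒱) x₂ :=
        (hr₂' x₂).trans (component_mono (Set.preimage_mono hsub) hid x₂)
      exact component_trans (hB' hz)
        (component_trans (component_symm (hm (hB₂x hz₂))) (hm (hB₂x hy)))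

/-- A large scale continuous map `f` is coarsely monotone if its light part, that is `f` regarded
as a map on `X` endowed with the light structure with respect to `f`, is a coarse equivalence. -/
def IsCoarselyMonotone {X : Type u} {Y : Type v} (LX : LargeScaleStructure X)
    (LY : LargeScaleStructure Y) (f : X → Y) : Prop :=
  LSContinuous LX LY f ∧ IsCoarseEquivalence (lightStructure LX LY f) LY f

/-! ## The Higson corona -/

/-- Slowly oscillating functions on a metric space (boundedness is imposed separately). -/
def SlowlyOscillating {X : Type u} [MetricSpace X] (g : X → ℂ) : Prop :=
  ∀ R : ℝ, 0 < R → ∀ ε : ℝ, 0 < ε → ∃ B : Set X, Bornology.IsBounded B ∧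
    ∀ x ∉ B, ∀ x' ∉ B, dist x x' ≤ R → ‖g x - g x'‖ ≤ ε

/-- The C⋆-algebra of all bounded functions `X → ℂ` with the supremum norm. -/
abbrev BoundedFunctions (X : Type u) : Type u := lp (fun _ : X => ℂ) ∞

theorem SlowlyOscillating.mul {X : Type u} [MetricSpace X] (g h : BoundedFunctions X)
    (hg : SlowlyOscillating (g : X → ℂ)) (hh : SlowlyOscillating (h : X → ℂ)) :
    SlowlyOscillating ((g * h : BoundedFunctions X) : X → ℂ) := by
  intro R hR ε hε
  have hC : 0 < ‖g‖ + ‖h‖ + 1 := by positivity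
  have hδ : 0 < ε / (‖g‖ + ‖h‖ + 1) := div_pos hε hC
  obtain ⟨B₁, hB₁, h₁⟩ := hg R hR _ hδ
  obtain ⟨B₂, hB₂, h₂⟩ := hh R hR _ hδ
  refine ⟨B₁ ∪ B₂, hB₁.union hB₂, fun x hx x' hx' hd => ?_⟩
  rw [Set.mem_union, not_or] at hx hx'
  have e₁ := h₁ x hx.1 x' hx'.1 hd
  have e₂ := h₂ x hx.2 x' hx'.2 hd
  have n₁ : ‖g x‖ ≤ ‖g‖ := lp.norm_apply_le_norm ENNReal.top_ne_zero g x
  have n₂ : ‖h x'‖ ≤ ‖h‖ := lp.norm_apply_le_norm ENNReal.top_ne_zero h x'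
  have : (g * h : BoundedFunctions X) x - (g * h : BoundedFunctions X) x' =
      g x * (h x - h x') + (g x - g x') * h x' := by
    simp only [lp.infty_coeFn_mul, Pi.mul_apply]
    ring
  rw [this]
  calc ‖g x * (h x - h x') + (g x - g x') * h x'‖
      ≤ ‖g x‖ * ‖h x - h x'‖ + ‖g x - g x'‖ * ‖h x'‖ := by
        refine (norm_add_le _ _).trans ?_
        rw [norm_mul, norm_mul]
    _ ≤ ‖g‖ * (ε / (‖g‖ + ‖h‖ + 1)) + (ε / (‖g‖ + ‖h‖ + 1)) * ‖h‖ := by gcongr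
    _ = (‖g‖ + ‖h‖) * (ε / (‖g‖ + ‖h‖ + 1)) := by ring
    _ ≤ (‖g‖ + ‖h‖ + 1) * (ε / (‖g‖ + ‖h‖ + 1)) := by 
        exact mul_le_mul_of_nonneg_right (by linarith) hδ.le
    _ = ε := by field_simp

theorem SlowlyOscillating.add {X : Type u} [MetricSpace X] {g h : X → ℂ}
    (hg : SlowlyOscillating g) (hh : SlowlyOscillating h) : SlowlyOscillating (g + h) := by
  intro R hR ε hε
  obtain ⟨B₁, hB₁, h₁⟩ := hg R hR (ε / 2) (half_pos hε)
  obtain ⟨B₂, hB₂, h₂⟩ := hh R hR (ε / 2) (half_pos hε)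
  refine ⟨B₁ ∪ B₂, hB₁.union hB₂, fun x hx x' hx' hd => ?_⟩
  rw [Set.mem_union, not_or] at hx hx'
  have e₁ := h₁ x hx.1 x' hx'.1 hd
  have e₂ := h₂ x hx.2 x' hx'.2 hd
  have : (g + h) x - (g + h) x' = (g x - g x') + (h x - h x') := by
    simp only [Pi.add_apply]
    ring
  rw [this]
  exact (norm_add_le _ _).trans (by linarith)

/-- The bounded, not necessarily continuous, slowly oscillating functions, as a star subalgebra of
the algebra of bounded functions. -/
def slowlyOscillatingAlgebra (X : Type u) [MetricSpace X] :
    StarSubalgebra ℂ (BoundedFunctions X) where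
  carrier := {g | SlowlyOscillating (g : X → ℂ)}
  mul_mem' {g h} hg hh := SlowlyOscillating.mul g h hg hh
  add_mem' {g h} hg hh := SlowlyOscillating.add hg hh
  algebraMap_mem' c := by
    intro R _ ε hε
    refine ⟨∅, Bornology.isBounded_empty, fun x _ x' _ _ => ?_⟩
    have : ∀ y : X, (algebraMap ℂ (BoundedFunctions X) c) y = c := fun y => rfl
    rw [this, this, sub_self, norm_zero]
    exact hε.le
  star_mem' {g} hg := by
    intro R hR ε hε
    obtain ⟨B, hB, h⟩ := hg R hR ε hε
    refine ⟨B, hB, fun x hx x' hx' hd => ?_⟩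
    rw [lp.star_apply, lp.star_apply, ← star_sub, norm_star]
    exact h x hx x' hx' hd

/-- The C⋆-algebra `B_h(X)` of bounded slowly oscillating functions, with the supremum norm. -/
def SlowlyOscillatingFunctions (X : Type u) [MetricSpace X] : Type u := slowlyOscillatingAlgebra X

instance (X : Type u) [MetricSpace X] : NormedCommRing (SlowlyOscillatingFunctions X) :=
  inferInstanceAs (NormedCommRing (slowlyOscillatingAlgebra X))

instance (X : Type u) [MetricSpace X] : NormedAlgebra ℂ (SlowlyOscillatingFunctions X) :=
  inferInstanceAs (NormedAlgebra ℂ (slowlyOscillatingAlgebra X))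

/-- The ideal `B_0(X)` of `B_h(X)` of the functions tending to zero at infinity, that is, along the
filter of complements of bounded sets. -/
def vanishingIdeal (X : Type u) [MetricSpace X] : Ideal (SlowlyOscillatingFunctions X) where
  carrier := {g | Filter.Tendsto (fun x => g.1 x)
    (Bornology.cobounded X) (𝓝 0)}
  add_mem' {g h} hg hh := by
    have := Filter.Tendsto.add hg hh
    rw [add_zero] at this
    exact this
  zero_mem' := tendsto_const_nhds
  smul_mem' c g hg := by
    have hb : ∀ x, ‖c.1 x‖ ≤ ‖c.1‖ := fun x =>
      lp.norm_apply_le_norm ENNReal.top_ne_zero c.1 x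
    refine squeeze_zero_norm (a := fun x => ‖c.1‖ *
      ‖g.1 x‖) (fun x => ?_) ?_
    · have : (c • g : SlowlyOscillatingFunctions X).1 x =
        c.1 x * g.1 x := rfl
      rw [this, norm_mul]
      exact mul_le_mul_of_nonneg_right (hb x) (norm_nonneg _)
    · have := (Filter.Tendsto.norm hg).const_mul ‖c.1‖
      rw [norm_zero, mul_zero] at this
      exact this

/-- The C⋆-algebra `B_h(X)/B_0(X)`, with the quotient norm. -/
abbrev CoronaAlgebra (X : Type u) [MetricSpace X] : Type u :=
  SlowlyOscillatingFunctions X ⧸ vanishingIdeal X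

/-- The Higson corona `νX`: the Gelfand dual of `B_h(X)/B_0(X)`, that is, the space of its
characters with the weak-⋆ topology. -/
abbrev HigsonCorona (X : Type u) [MetricSpace X] : Type u :=
  WeakDual.characterSpace ℂ (CoronaAlgebra X)

theorem metricStructure_bounded_iff {X : Type u} [MetricSpace X] (B : Set X) :
    (metricStructure X).Bounded B ↔ Bornology.IsBounded B := by
  rw [Metric.isBounded_iff]
  constructor
  · rintro ⟨𝒰, ⟨M, -, h⟩, hB⟩
    exact ⟨M, fun x hx y hy => h B hB x hx y hy⟩
  · rintro ⟨C, hC⟩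
    refine ⟨{B}, ⟨max C 1, by positivity, ?_⟩, rfl⟩
    rintro _ rfl x hx y hy
    exact (hC hx hy).trans (le_max_left _ _)

section Functoriality

variable {X : Type u} {Y : Type v} [MetricSpace X] [MetricSpace Y] {f : X → Y}

theorem IsCoarseMap.isBounded_preimage (hf : IsCoarseMap (metricStructure X) (metricStructure Y) f)
    {B : Set Y} (hB : Bornology.IsBounded B) : Bornology.IsBounded (f ⁻¹' B) :=
  (metricStructure_bounded_iff _).1 (hf.2 B ((metricStructure_bounded_iff B).2 hB))

theorem IsCoarseMap.exists_dist_le (hf : IsCoarseMap (metricStructure X) (metricStructure Y) f)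
    (R : ℝ) (hR : 0 < R) : ∃ S : ℝ, 0 < S ∧ ∀ x x', dist x x' ≤ R → dist (f x) (f x') ≤ S := by
  obtain ⟨S, hS, h⟩ := hf.1 {U | ∀ x ∈ U, ∀ y ∈ U, dist x y ≤ R} ⟨R, hR, fun U hU => hU⟩
  refine ⟨S, hS, fun x x' hd => ?_⟩
  refine h _ ⟨{x, x'}, ?_, rfl⟩ _ ⟨x, by simp, rfl⟩ _ ⟨x', by simp, rfl⟩
  rintro a (rfl | rfl) b (rfl | rfl)
  · simpa using hR.le
  · exact hd
  · rwa [dist_comm]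
  · simpa using hR.le

theorem SlowlyOscillating.comp {g : Y → ℂ} (hg : SlowlyOscillating g)
    (hf : IsCoarseMap (metricStructure X) (metricStructure Y) f) :
    SlowlyOscillating (fun x => g (f x)) := by
  intro R hR ε hε
  obtain ⟨S, hS, hfS⟩ := hf.exists_dist_le R hR
  obtain ⟨B, hB, h⟩ := hg S hS ε hε
  exact ⟨f ⁻¹' B, hf.isBounded_preimage hB,
    fun x hx x' hx' hd => h (f x) hx (f x') hx' (hfS x x' hd)⟩

/-- The pull-back `g ↦ g ∘ f` of bounded functions. -/
def boundedComp (f : X → Y) (g : BoundedFunctions Y) : BoundedFunctions X :=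
  ⟨fun x => g (f x), memℓp_infty
    ⟨‖g‖, by rintro _ ⟨x, rfl⟩; exact lp.norm_apply_le_norm ENNReal.top_ne_zero g (f x)⟩⟩

/-- The homomorphism `B_h(Y) → B_h(X)`, `g ↦ g ∘ f`, for a coarse map `f`. -/
def pullback (f : X → Y) (hf : IsCoarseMap (metricStructure X) (metricStructure Y) f) :
    SlowlyOscillatingFunctions Y →ₐ[ℂ] SlowlyOscillatingFunctions X where
  toFun g := ⟨boundedComp f g.1, SlowlyOscillating.comp (g := g.1) g.2 hf⟩
  map_one' := rfl
  map_mul' _ _ := rfl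
  map_zero' := rfl
  map_add' _ _ := rfl
  commutes' _ := rfl

theorem vanishingIdeal_le_comap (hf : IsCoarseMap (metricStructure X) (metricStructure Y) f) :
    vanishingIdeal Y ≤ (vanishingIdeal X).comap (pullback f hf) := by
  intro g hg
  have hcob : Filter.Tendsto f (Bornology.cobounded X) (Bornology.cobounded Y) := by
    intro s hs
    rw [← Bornology.isCobounded_def, ← Bornology.isBounded_compl_iff] at hs
    rw [Filter.mem_map, ← Bornology.isCobounded_def, ← Bornology.isBounded_compl_iff]
    exact hf.isBounded_preimage hs
  have hg' : Filter.Tendsto (fun y => g.1 y)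
    (Bornology.cobounded Y) (𝓝 0) := hg
  exact hg'.comp hcob

/-- The homomorphism `f^* : B_h(Y)/B_0(Y) → B_h(X)/B_0(X)`, `[g] ↦ [g ∘ f]`. -/
def coronaPullback (f : X → Y) (hf : IsCoarseMap (metricStructure X) (metricStructure Y) f) :
    CoronaAlgebra Y →ₐ[ℂ] CoronaAlgebra X :=
  Ideal.quotientMapₐ (vanishingIdeal X) (pullback f hf) (vanishingIdeal_le_comap hf)

theorem continuous_pullback (hf : IsCoarseMap (metricStructure X) (metricStructure Y) f) :
    Continuous (pullback f hf) := by
  refine AddMonoidHomClass.continuous_of_bound (pullback f hf) 1 fun g => ?_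
  rw [one_mul]
  exact lp.norm_le_of_forall_le (norm_nonneg _) fun x =>
    lp.norm_apply_le_norm ENNReal.top_ne_zero g.1 (f x)

theorem continuous_coronaPullback
    (hf : IsCoarseMap (metricStructure X) (metricStructure Y) f) :
    Continuous (coronaPullback f hf) := by
  refine continuous_quot_lift _ ?_
  exact continuous_quot_mk.comp (continuous_pullback hf)

/-- The continuous map `νf : νX → νY` induced by a coarse map `f`: the Gelfand dual
`φ ↦ φ ∘ f^*` of `f^*`. -/
def coronaMap (f : X → Y) (hf : IsCoarseMap (metricStructure X) (metricStructure Y) f) :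
    C(HigsonCorona X, HigsonCorona Y) where
  toFun φ :=
    ⟨(WeakDual.CharacterSpace.toCLM φ).comp
      ⟨(coronaPullback f hf).toLinearMap, continuous_coronaPullback hf⟩, by
      rw [WeakDual.CharacterSpace.eq_set_map_one_map_mul]
      constructor
      · change φ (coronaPullback f hf 1) = 1
        rw [map_one, map_one]
      · intro a b
        change φ (coronaPullback f hf (a * b)) =
          φ (coronaPullback f hf a) * φ (coronaPullback f hf b)
        rw [map_mul, map_mul]⟩
  continuous_toFun := by
    refine Continuous.subtype_mk (WeakDual.continuous_of_continuous_eval fun a => ?_) _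
    exact (WeakDual.eval_continuous (coronaPullback f hf a)).comp continuous_subtype_val

end Functoriality

/-- A continuous map is (classically) monotone if it is surjective with connected fibres. -/
def IsMonotoneMap {K : Type u} {L : Type v} [TopologicalSpace K] [TopologicalSpace L]
    (h : C(K, L)) : Prop :=
  Function.Surjective h ∧ ∀ y : L, IsConnected (h ⁻¹' {y})

end Coarse

end

namespace Coarse

open Filter Bornology

universe u v

variable {X : Type u} {Y : Type v} [MetricSpace X] [MetricSpace Y] {f : X → Y}

/-! The theorem is proved by unwinding both sides into statements about $f$ at large scale. Coarse
monotonicity amounts to two metric conditions: the image of $f$ is coarsely dense, and points whose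
images are at distance at most $R$ are joined by chains with steps of size $r(R)$ over a ball of
radius $s(R)$ (`isCoarselyMonotone_iff`). The first condition is matched with surjectivity of $\nu
f$, the second with connectedness of its fibres.

The link to the corona is that its points are exactly the limits along ultrafilters on $X$
converging to infinity (`HigsonCorona.exists_ultrafilter`). Consequently $\nu X$ is compact, and
disjoint closed sets in it are separated by slowly oscillating functions (`exists_separating`). In
the other direction, asymptotically disjoint sets in a metric space have disjoint closures at
infinity (`AsymptoticallyDisjoint.exists_function`).

If chains exist but a fibre of $\nu f$ splits, a function $h$ separates the two pieces. Far out
there is a chain, over a small region of $Y$, from where $h$ is near $0$ to where it is near $1$.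
Since $h$ changes little at each step, the chain passes through a middle value, and such points
accumulate at no point of the fibre: a contradiction.

If chains fail to exist, there are pairs $x_n, x_n'$ with close images that are not joined at scales
$k_n \to \infty$. Tent functions of radius $k_n$ around $f(x_n)$ add up to $g$ on $Y$; cutting their
pullbacks down to the chain component of $x_n$ gives $h$ on $X$, still slowly oscillating, with $h(h
- g\circ f) = 0$. On the fibre through the limit of the $x_n$ one has $g\circ f = 1$, so there $h$
takes only the values $0$ and $1$, and it takes both: the fibre is disconnected. -/

/-! ### Points of the corona as limits along ultrafilters. -/

/-- The element of `B_h(X)` given by a bounded slowly oscillating function. -/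
noncomputable def SlowlyOscillating.toFunctions (g : X → ℂ) (hg : SlowlyOscillating g)
    (hb : ∃ C, ∀ x, ‖g x‖ ≤ C) : SlowlyOscillatingFunctions X :=
  ⟨⟨g, memℓp_infty (by obtain ⟨C, hC⟩ := hb; exact ⟨C, by rintro _ ⟨x, rfl⟩; exact hC x⟩)⟩, hg⟩

/-- The value of a character of the corona algebra at the class of a slowly oscillating function. -/
noncomputable def HigsonCorona.eval (φ : HigsonCorona X) : SlowlyOscillatingFunctions X →ₐ[ℂ] ℂ :=
  (WeakDual.CharacterSpace.toAlgHom φ).comp (Ideal.Quotient.mkₐ ℂ (vanishingIdeal X))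

theorem HigsonCorona.eval_apply (φ : HigsonCorona X) (g : SlowlyOscillatingFunctions X) :
    φ.eval g = φ (Ideal.Quotient.mk (vanishingIdeal X) g) := rfl

theorem HigsonCorona.ext_eval {φ ψ : HigsonCorona X} (h : ∀ g, φ.eval g = ψ.eval g) : φ = ψ := by
  refine WeakDual.CharacterSpace.ext fun a => ?_
  obtain ⟨g, rfl⟩ := Ideal.Quotient.mk_surjective a
  exact h g

theorem HigsonCorona.continuous_eval (g : SlowlyOscillatingFunctions X) :
    Continuous fun φ : HigsonCorona X => φ.eval g :=
  (WeakDual.eval_continuous (Ideal.Quotient.mk (vanishingIdeal X) g)).comp continuous_subtype_val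

theorem HigsonCorona.tendsto_iff {ι : Type*} {l : Filter ι} {F : ι → HigsonCorona X}
    {φ : HigsonCorona X} :
    Tendsto F l (𝓝 φ) ↔ ∀ g, Tendsto (fun i => (F i).eval g) l (𝓝 (φ.eval g)) := by
  rw [Topology.IsInducing.subtypeVal.tendsto_nhds_iff, tendsto_iff_forall_eval_tendsto_topDualPairing]
  refine ⟨fun h g => h (Ideal.Quotient.mk _ g), fun h a => ?_⟩
  obtain ⟨g, rfl⟩ := Ideal.Quotient.mk_surjective a
  exact h g

theorem HigsonCorona.eval_eq_zero_of_tendsto (φ : HigsonCorona X)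
    {g : SlowlyOscillatingFunctions X} (hg : Tendsto (fun x => g.1 x) (cobounded X) (𝓝 0)) :
    φ.eval g = 0 := by
  have : Ideal.Quotient.mk (vanishingIdeal X) g = 0 := Ideal.Quotient.eq_zero_iff_mem.2 hg
  rw [HigsonCorona.eval_apply, this, map_zero]

theorem eval_coronaMap {f : X → Y} (hf : IsCoarseMap (metricStructure X) (metricStructure Y) f)
    (φ : HigsonCorona X) (g : SlowlyOscillatingFunctions Y) :
    (coronaMap f hf φ).eval g = φ.eval (pullback f hf g) := rfl

theorem SlowlyOscillatingFunctions.norm_apply_le (g : SlowlyOscillatingFunctions X) (x : X) :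
    ‖g.1 x‖ ≤ ‖g‖ :=
  lp.norm_apply_le_norm ENNReal.top_ne_zero g.1 x

theorem exists_tendsto_ultrafilter (p : Ultrafilter X) (g : SlowlyOscillatingFunctions X) :
    ∃ c, ‖c‖ ≤ ‖g‖ ∧ Tendsto (fun x => g.1 x) p (𝓝 c) := by
  have hK : IsCompact (Metric.closedBall (0 : ℂ) ‖g‖) := isCompact_closedBall _ _
  obtain ⟨c, hc, h⟩ := hK.ultrafilter_le_nhds (p.map fun x => g.1 x) (by
    rw [le_principal_iff]
    exact Filter.mem_map.2 (Filter.univ_mem' fun x => by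
      simpa using SlowlyOscillatingFunctions.norm_apply_le g x))
  exact ⟨c, by simpa using hc, h⟩

/-- The limit along an ultrafilter as a homomorphism on the slowly oscillating functions. -/
noncomputable def ultrafilterLimit (p : Ultrafilter X) : SlowlyOscillatingFunctions X →ₐ[ℂ] ℂ where
  toFun g := (exists_tendsto_ultrafilter p g).choose
  map_one' := tendsto_nhds_unique (exists_tendsto_ultrafilter p 1).choose_spec.2
    (tendsto_const_nhds (x := (1 : ℂ)))
  map_mul' g h := tendsto_nhds_unique (exists_tendsto_ultrafilter p (g * h)).choose_spec.2
    ((exists_tendsto_ultrafilter p g).choose_spec.2.mul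
      (exists_tendsto_ultrafilter p h).choose_spec.2)
  map_zero' := tendsto_nhds_unique (exists_tendsto_ultrafilter p 0).choose_spec.2
    (tendsto_const_nhds (x := (0 : ℂ)))
  map_add' g h := tendsto_nhds_unique (exists_tendsto_ultrafilter p (g + h)).choose_spec.2
    ((exists_tendsto_ultrafilter p g).choose_spec.2.add
      (exists_tendsto_ultrafilter p h).choose_spec.2)
  commutes' c := tendsto_nhds_unique (exists_tendsto_ultrafilter p (algebraMap ℂ _ c)).choose_spec.2
    (tendsto_const_nhds (x := c))

theorem tendsto_ultrafilterLimit (p : Ultrafilter X) (g : SlowlyOscillatingFunctions X) :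
    Tendsto (fun x => g.1 x) p (𝓝 (ultrafilterLimit p g)) :=
  (exists_tendsto_ultrafilter p g).choose_spec.2

theorem norm_ultrafilterLimit_le (p : Ultrafilter X) (g : SlowlyOscillatingFunctions X) :
    ‖ultrafilterLimit p g‖ ≤ ‖g‖ :=
  (exists_tendsto_ultrafilter p g).choose_spec.1

theorem continuous_ultrafilterLimit (p : Ultrafilter X) : Continuous (ultrafilterLimit p) :=
  AddMonoidHomClass.continuous_of_bound (ultrafilterLimit p) 1 fun g => by
    rw [one_mul]
    exact norm_ultrafilterLimit_le p g

/-- The point of the Higson corona defined by an ultrafilter converging to infinity. -/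
noncomputable def HigsonCorona.ofUltrafilter (p : Ultrafilter X)
    (hp : (p : Filter X) ≤ cobounded X) : HigsonCorona X :=
  let L : CoronaAlgebra X →ₐ[ℂ] ℂ := Ideal.Quotient.liftₐ (vanishingIdeal X) (ultrafilterLimit p)
    fun g hg => tendsto_nhds_unique (tendsto_ultrafilterLimit p g)
      ((show Tendsto (fun x => g.1 x) (cobounded X) (𝓝 0) from hg).mono_left hp)
  ⟨⟨L.toLinearMap, continuous_quot_lift _ (continuous_ultrafilterLimit p)⟩, by
    rw [WeakDual.CharacterSpace.eq_set_map_one_map_mul]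
    exact ⟨map_one L, map_mul L⟩⟩

theorem HigsonCorona.tendsto_ofUltrafilter (p : Ultrafilter X) (hp : (p : Filter X) ≤ cobounded X)
    (g : SlowlyOscillatingFunctions X) :
    Tendsto (fun x => g.1 x) p (𝓝 ((HigsonCorona.ofUltrafilter p hp).eval g)) :=
  tendsto_ultrafilterLimit p g

/-- Pointwise complex conjugation of slowly oscillating functions. -/
noncomputable def SlowlyOscillatingFunctions.conj (g : SlowlyOscillatingFunctions X) :
    SlowlyOscillatingFunctions X :=
  ⟨star g.1, star_mem (s := slowlyOscillatingAlgebra X) g.2⟩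

theorem SlowlyOscillatingFunctions.conj_apply (g : SlowlyOscillatingFunctions X) (x : X) :
    g.conj.1 x = star (g.1 x) := rfl

theorem SlowlyOscillatingFunctions.mul_apply (g h : SlowlyOscillatingFunctions X) (x : X) :
    (g * h).1 x = g.1 x * h.1 x := rfl

theorem SlowlyOscillatingFunctions.add_apply (g h : SlowlyOscillatingFunctions X) (x : X) :
    (g + h).1 x = g.1 x + h.1 x := rfl

/-- A slowly oscillating function bounded away from zero is not in the kernel of a character. -/
theorem HigsonCorona.exists_norm_lt (φ : HigsonCorona X) (g : SlowlyOscillatingFunctions X)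
    (hg : φ.eval g = 0) (ε : ℝ) (hε : 0 < ε) : ∃ x, ‖g.1 x‖ < ε := by
  by_contra! hlow
  have hne : ∀ x, g.1 x ≠ 0 := fun x h => by
    have := hlow x
    rw [h, norm_zero] at this
    linarith
  -- The inverse is bounded by $1/\varepsilon$ and slowly oscillating, since $|1/a - 1/b| =
  -- |a-b|/|ab| \le |a-b|/\varepsilon^2$. So $g$ is a unit, and no character kills a unit.
  have hinv : SlowlyOscillating fun x => (g.1 x)⁻¹ := by
    intro R hR δ hδ
    obtain ⟨B, hB, h⟩ := g.2 R hR (δ * (ε * ε)) (by positivity)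
    refine ⟨B, hB, fun x hx x' hx' hd => ?_⟩
    rw [inv_sub_inv (hne x) (hne x'), norm_div, norm_mul, norm_sub_rev,
      div_le_iff₀ (mul_pos (norm_pos_iff.2 (hne x)) (norm_pos_iff.2 (hne x')))]
    refine (h x hx x' hx' hd).trans ?_
    gcongr
    · exact hlow x
    · exact hlow x'
  let k := hinv.toFunctions _ ⟨ε⁻¹, fun x => by
    rw [norm_inv]
    exact inv_anti₀ hε (hlow x)⟩
  have hk : g * k = 1 := Subtype.ext (lp.ext (funext fun x => mul_inv_cancel₀ (hne x)))
  have := congrArg φ.eval hk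
  rw [map_mul, hg, zero_mul, map_one] at this
  exact zero_ne_one this

theorem slowlyOscillating_indicator {B : Set X} (hB : IsBounded B) :
    SlowlyOscillating (B.indicator fun _ => (1 : ℂ)) := by
  intro R _ ε hε
  refine ⟨B, hB, fun x hx x' hx' _ => ?_⟩
  rw [Set.indicator_of_notMem hx, Set.indicator_of_notMem hx', sub_zero, norm_zero]
  exact hε.le

/-- The filter of the sets containing a set of the form `{|g| < ε}` with `φ(g) = 0`. -/
def HigsonCorona.kernelFilter (φ : HigsonCorona X) : Filter X where
  sets := {s | ∃ g, φ.eval g = 0 ∧ ∃ ε : ℝ, 0 < ε ∧ ∀ x, ‖g.1 x‖ < ε → x ∈ s}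
  univ_sets := ⟨0, map_zero _, 1, one_pos, fun _ _ => trivial⟩
  sets_of_superset := by
    rintro s t ⟨g, hg, ε, hε, h⟩ hst
    exact ⟨g, hg, ε, hε, fun x hx => hst (h x hx)⟩
  inter_sets := by
    rintro s t ⟨g, hg, ε, hε, hs⟩ ⟨h, hh, δ, hδ, ht⟩
    -- The function $|g|^2 + |h|^2$ is again killed by $\varphi$, and it is small only where both
    -- $g$ and $h$ are small.
    refine ⟨g * g.conj + h * h.conj, by simp [hg, hh], min (ε ^ 2) (δ ^ 2), by positivity,
      fun x hx => ?_⟩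
    have key : ‖(g * g.conj + h * h.conj).1 x‖ = ‖g.1 x‖ ^ 2 + ‖h.1 x‖ ^ 2 := by
      simp only [SlowlyOscillatingFunctions.add_apply, SlowlyOscillatingFunctions.mul_apply,
        SlowlyOscillatingFunctions.conj_apply, Complex.star_def, Complex.mul_conj,
        Complex.normSq_eq_norm_sq]
      rw [← Complex.ofReal_add, Complex.norm_real, Real.norm_of_nonneg (by positivity)]
    rw [key, lt_min_iff] at hx
    exact ⟨hs x (lt_of_pow_lt_pow_left₀ 2 hε.le (by nlinarith [sq_nonneg ‖h.1 x‖])),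
      ht x (lt_of_pow_lt_pow_left₀ 2 hδ.le (by nlinarith [sq_nonneg ‖g.1 x‖]))⟩

theorem HigsonCorona.kernelFilter_neBot (φ : HigsonCorona X) : NeBot φ.kernelFilter := by
  refine ⟨fun h => ?_⟩
  have : (∅ : Set X) ∈ φ.kernelFilter := by rw [h]; trivial
  obtain ⟨g, hg, ε, hε, hx⟩ := this
  obtain ⟨x, hxε⟩ := φ.exists_norm_lt g hg ε hε
  exact hx x hxε

/-- The indicator of a bounded set vanishes at infinity, hence lies in the kernel, and it is less
than $1$ exactly off that set. -/
theorem HigsonCorona.kernelFilter_le (φ : HigsonCorona X) : φ.kernelFilter ≤ cobounded X := by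
  intro s hs
  have hB : IsBounded sᶜ := isBounded_compl_iff.2 (isCobounded_def.2 hs)
  let g := (slowlyOscillating_indicator hB).toFunctions _ ⟨1, fun x => by
    by_cases hx : x ∈ sᶜ
    · rw [Set.indicator_of_mem hx, norm_one]
    · rw [Set.indicator_of_notMem hx, norm_zero]
      exact zero_le_one⟩
  refine ⟨g, φ.eval_eq_zero_of_tendsto ?_, 1, one_pos, fun x hx => ?_⟩
  · refine tendsto_const_nhds.congr' ?_
    filter_upwards [hs] with x hx
    exact (Set.indicator_of_notMem (Set.notMem_compl_iff.2 hx) fun _ => (1 : ℂ)).symm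
  · by_contra hxs
    have : g.1 x = 1 := Set.indicator_of_mem (s := sᶜ) hxs fun _ => (1 : ℂ)
    rw [this, norm_one] at hx
    exact lt_irrefl _ hx

/-- Every point of the Higson corona is given by an ultrafilter converging to infinity. -/
theorem HigsonCorona.exists_ultrafilter (φ : HigsonCorona X) :
    ∃ p : Ultrafilter X, (p : Filter X) ≤ cobounded X ∧
      ∀ g, Tendsto (fun x => g.1 x) p (𝓝 (φ.eval g)) := by
  have := φ.kernelFilter_neBot
  refine ⟨Ultrafilter.of φ.kernelFilter, (Ultrafilter.of_le _).trans φ.kernelFilter_le,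
    fun g => ?_⟩
  refine Tendsto.mono_left ?_ (Ultrafilter.of_le _)
  rw [Metric.tendsto_nhds]
  intro ε hε
  -- Subtracting the constant $\varphi(g)$ moves $g$ into the kernel.
  refine ⟨g - algebraMap ℂ _ (φ.eval g), by simp, ε, hε, fun x hx => ?_⟩
  rw [Set.mem_ofPred, dist_eq_norm]
  exact hx

theorem HigsonCorona.eval_conj (φ : HigsonCorona X) (g : SlowlyOscillatingFunctions X) :
    φ.eval g.conj = star (φ.eval g) := by
  obtain ⟨p, -, h⟩ := φ.exists_ultrafilter
  exact tendsto_nhds_unique (h g.conj) ((continuous_star.tendsto _).comp (h g))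

/-! ### Compactness of the corona and separation of closed sets. -/

/-- Represent each $\varphi$ by an ultrafilter $P_\varphi$ on $X$. An ultrafilter $G$ on the corona
then converges to the point given by the iterated limit ultrafilter `G.bind P`, which still
converges to infinity. -/
instance : CompactSpace (HigsonCorona X) := by
  refine ⟨isCompact_iff_ultrafilter_le_nhds.2 fun G _ => ?_⟩
  choose P hP hPg using fun φ : HigsonCorona X => φ.exists_ultrafilter
  have hmem : ∀ s, s ∈ G.bind P ↔ ∀ᶠ φ in (G : Filter (HigsonCorona X)), s ∈ P φ :=
    fun s => Iff.rfl
  have hr : ((G.bind P : Ultrafilter X) : Filter X) ≤ cobounded X := fun s hs =>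
    (hmem s).2 (Eventually.of_forall fun φ => hP φ hs)
  refine ⟨.ofUltrafilter _ hr, trivial, ?_⟩
  rw [← tendsto_id', HigsonCorona.tendsto_iff]
  intro g
  rw [Metric.tendsto_nhds]
  intro ε hε
  have h := (hmem _).1 (Metric.tendsto_nhds.1 (HigsonCorona.tendsto_ofUltrafilter _ hr g) (ε / 2)
    (half_pos hε))
  filter_upwards [h] with φ hφ
  have : dist (φ.eval g) ((HigsonCorona.ofUltrafilter _ hr).eval g) ≤ ε / 2 :=
    le_of_tendsto ((hPg φ g).dist tendsto_const_nhds) (by filter_upwards [hφ] with x hx using hx.le)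
  exact this.trans_lt (half_lt_self hε)

/-- The slowly oscillating functions as continuous functions on the Higson corona. -/
noncomputable def coronaFunctions (X : Type u) [MetricSpace X] :
    StarSubalgebra ℂ C(HigsonCorona X, ℂ) where
  carrier := {F | ∃ g : SlowlyOscillatingFunctions X, ∀ φ, F φ = φ.eval g}
  mul_mem' := by
    rintro F G ⟨g, hg⟩ ⟨h, hh⟩
    exact ⟨g * h, fun φ => by rw [ContinuousMap.mul_apply, hg, hh, map_mul]⟩
  add_mem' := by
    rintro F G ⟨g, hg⟩ ⟨h, hh⟩
    exact ⟨g + h, fun φ => by rw [ContinuousMap.add_apply, hg, hh, map_add]⟩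
  algebraMap_mem' c := ⟨algebraMap ℂ _ c, fun φ => by rw [AlgHom.commutes]; rfl⟩
  star_mem' := by
    rintro F ⟨g, hg⟩
    exact ⟨g.conj, fun φ => by rw [ContinuousMap.star_apply, hg, φ.eval_conj]⟩

/-- Stone–Weierstrass: characters are distinguished by their values on slowly oscillating functions.
-/
theorem coronaFunctions_topologicalClosure : (coronaFunctions X).topologicalClosure = ⊤ := by
  refine ContinuousMap.starSubalgebra_topologicalClosure_eq_top_of_separatesPoints _ ?_
  intro φ ψ hne
  obtain ⟨g, hg⟩ : ∃ g, φ.eval g ≠ ψ.eval g := by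
    by_contra! h
    exact hne (HigsonCorona.ext_eval h)
  exact ⟨_, ⟨⟨fun φ => φ.eval g, HigsonCorona.continuous_eval g⟩, ⟨g, fun _ => rfl⟩, rfl⟩, hg⟩

/-- Disjoint closed subsets of the Higson corona are separated by a slowly oscillating function. -/
theorem exists_separating {K L : Set (HigsonCorona X)} (hK : IsClosed K) (hL : IsClosed L)
    (hKL : Disjoint K L) : ∃ g : SlowlyOscillatingFunctions X,
      (∀ φ ∈ K, (φ.eval g).re < 1 / 4) ∧ ∀ φ ∈ L, 3 / 4 < (φ.eval g).re := by
  obtain ⟨F, hF0, hF1, -⟩ := exists_continuous_zero_one_of_isClosed hK hL hKL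
  let F' : C(HigsonCorona X, ℂ) := ⟨fun φ => (F φ : ℂ), by fun_prop⟩
  have hF' : F' ∈ closure (coronaFunctions X : Set C(HigsonCorona X, ℂ)) := by
    rw [← StarSubalgebra.topologicalClosure_coe, coronaFunctions_topologicalClosure]
    trivial
  -- The Urysohn function is $0$ on $K$ and $1$ on $L$; an error below $1/4$ gives the thresholds
  -- $1/4$ and $3/4$.
  obtain ⟨G, ⟨g, hg⟩, hG⟩ := Metric.mem_closure_iff.1 hF' (1 / 4) (by norm_num)
  have key : ∀ φ, |F φ - (φ.eval g).re| < 1 / 4 := fun φ => by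
    have h1 : ‖F' φ - G φ‖ < 1 / 4 := by
      rw [← dist_eq_norm]
      exact (ContinuousMap.dist_apply_le_dist φ).trans_lt hG
    have h2 := Complex.abs_re_le_norm (F' φ - G φ)
    rw [Complex.sub_re, hg] at h2
    exact lt_of_le_of_lt h2 (by rwa [hg] at h1)
  refine ⟨g, fun φ hφ => ?_, fun φ hφ => ?_⟩
  · have := key φ
    rw [hF0 hφ, abs_lt] at this
    simp only [Pi.zero_apply] at this
    linarith
  · have := key φ
    rw [hF1 hφ, abs_lt] at this
    simp only [Pi.one_apply] at this
    linarith

/-- An unbounded set contains a point of the Higson corona in its closure. -/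
theorem exists_ultrafilter_of_unbounded {Z : Set X} (hZ : ¬ IsBounded Z) :
    ∃ p : Ultrafilter X, (p : Filter X) ≤ cobounded X ∧ Z ∈ p := by
  have : NeBot (cobounded X ⊓ 𝓟 Z) := by
    rw [← frequently_mem_iff_neBot]
    intro h
    exact hZ (isCobounded_compl_iff.1 (isCobounded_def.2 h))
  have h := Ultrafilter.of_le (cobounded X ⊓ 𝓟 Z)
  exact ⟨_, h.trans inf_le_left, le_principal_iff.1 (h.trans inf_le_right)⟩

/-! ### Coarse monotonicity in metric terms. -/

/-- The points `x` and `x'` are joined by a chain of steps of length at most `r` inside the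
preimage under `f` of the closed ball of radius `s` about `c`. -/
def Joined (f : X → Y) (r s : ℝ) (c : Y) : X → X → Prop :=
  Relation.ReflTransGen fun a b => dist a b ≤ r ∧ dist (f a) c ≤ s ∧ dist (f b) c ≤ s

theorem Joined.mono {f : X → Y} {r r' s s' : ℝ} {c c' : Y} {x x' : X} (h : Joined f r s c x x')
    (hr : r ≤ r') (hs : s + dist c c' ≤ s') : Joined f r' s' c' x x' := by
  refine Relation.ReflTransGen.mono ?_ _ _ h
  rintro a b ⟨hab, ha, hb⟩
  have h₁ := dist_triangle (f a) c c'
  have h₂ := dist_triangle (f b) c c'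
  exact ⟨hab.trans hr, by linarith, by linarith⟩

/-- Every point of the target is within a fixed distance from the image. -/
def CoarselySurjective (f : X → Y) : Prop :=
  ∃ S : ℝ, ∀ y, ∃ x, dist (f x) y ≤ S

/-- Points with images at distance at most `R` are joined by chains of uniformly bounded steps in
preimages of uniformly bounded balls. -/
def CoarselyConnectedFibres (f : X → Y) : Prop :=
  ∀ R : ℝ, ∃ r s : ℝ, ∀ x x', dist (f x) (f x') ≤ R → Joined f r s (f x) x x'

theorem joined_of_mem_component {f : X → Y} {𝒰 : Set (Set X)} {V : Set Y} {r s : ℝ}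
    (h𝒰 : ∀ U ∈ 𝒰, ∀ x ∈ U, ∀ y ∈ U, dist x y ≤ r) (hV : ∀ x ∈ V, ∀ y ∈ V, dist x y ≤ s)
    {x₀ x x' : X} (hx₀ : x₀ ∈ f ⁻¹' V) (hx : x ∈ component 𝒰 (f ⁻¹' V) x₀)
    (hx' : x' ∈ component 𝒰 (f ⁻¹' V) x₀) : Joined f r s (f x) x x' := by
  have hxV : f x ∈ V := component_subset hx₀ hx
  refine Relation.ReflTransGen.mono ?_ _ _ (component_trans (component_symm hx) hx')
  rintro a b ⟨ha, hb, U, hU, haU, hbU⟩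
  exact ⟨h𝒰 U hU a haU b hbU, hV _ ha _ hxV, hV _ hb _ hxV⟩

theorem Joined.mem_component {f : X → Y} {r s : ℝ} {x x' : X}
    (h : Joined f r s (f x) x x') :
    x' ∈ component {U | ∀ a ∈ U, ∀ b ∈ U, dist a b ≤ max r 0}
      (f ⁻¹' Metric.closedBall (f x) s) x := by
  refine Relation.ReflTransGen.mono ?_ _ _ h
  rintro a b ⟨hab, ha, hb⟩
  refine ⟨ha, hb, {a, b}, ?_, by simp, by simp⟩
  rintro p (rfl | rfl) q (rfl | rfl)
  · simp
  · exact hab.trans (le_max_left _ _)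
  · rw [dist_comm]
    exact hab.trans (le_max_left _ _)
  · simp

theorem mem_lightStructure_of_joined {f : X → Y} {r s : ℝ} {ℬ : Set (Set X)}
    (h : ∀ B ∈ ℬ, ∀ x ∈ B, ∀ x' ∈ B, Joined f r s (f x) x x') :
    ℬ ∈ (lightStructure (metricStructure X) (metricStructure Y) f).uniformlyBounded := by
  refine ⟨{U | ∀ a ∈ U, ∀ b ∈ U, dist a b ≤ max r 0},
    ⟨max r 1, by positivity, fun U hU x hx y hy => (hU x hx y hy).trans
      (max_le_max le_rfl zero_le_one)⟩,
    Set.range fun y => Metric.closedBall y (max s 1),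
    ⟨max s 1 + max s 1, by positivity, ?_⟩, ?_⟩
  · rintro _ ⟨c, rfl⟩ x hx y hy
    exact (dist_triangle_right x y c).trans (add_le_add hx hy)
  · rintro B hB ⟨x, hx, -⟩
    refine ⟨_, ⟨_, ⟨f x, rfl⟩, x, ?_, rfl⟩, fun x' hx' => ?_⟩
    · exact Metric.mem_closedBall_self (by positivity)
    · exact component_mono (Set.preimage_mono (Metric.closedBall_subset_closedBall
        (le_max_left _ _))) (fun U hU => ⟨U, hU, subset_rfl⟩) x (h B hB x hx x' hx').mem_component

/-- The converse of `mem_lightStructure_of_joined`. Refinement says nothing about members with one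
point, which are handled by the empty chain. -/
theorem exists_joined_of_mem_lightStructure {f : X → Y} {ℬ : Set (Set X)}
    (h : ℬ ∈ (lightStructure (metricStructure X) (metricStructure Y) f).uniformlyBounded) :
    ∃ r s : ℝ, 0 < s ∧ ∀ B ∈ ℬ, ∀ x ∈ B, ∀ x' ∈ B,
      dist (f x) (f x') ≤ s ∧ Joined f r s (f x) x x' := by
  obtain ⟨𝒰, ⟨r, -, h𝒰⟩, 𝒱, ⟨s, hs, h𝒱⟩, href⟩ := h
  refine ⟨r, s, hs, fun B hB x hx x' hx' => ?_⟩
  by_cases hxx : x = x'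
  · subst hxx
    exact ⟨by simpa using hs.le, Relation.ReflTransGen.refl⟩
  · obtain ⟨_, ⟨V, hV, x₀, hx₀, rfl⟩, hBC⟩ := href B hB ⟨x, hx, x', hx', hxx⟩
    exact ⟨h𝒱 V hV _ (component_subset hx₀ (hBC hx)) _ (component_subset hx₀ (hBC hx')),
      joined_of_mem_component h𝒰 (h𝒱 V hV) hx₀ (hBC hx) (hBC hx')⟩

/-- Given a coarse inverse $g$, a chain from $x$ to $x'$ is the concatenation $x \to gf(x) \to
gf(x') \to x'$, whose outer parts come from $g\circ f$ being close to the identity. Conversely, any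
choice of approximate preimages is a coarse inverse, the chain condition being exactly what makes
its image families bounded in the light structure. -/
theorem isCoarselyMonotone_iff {f : X → Y}
    (hf : LSContinuous (metricStructure X) (metricStructure Y) f) :
    IsCoarselyMonotone (metricStructure X) (metricStructure Y) f ↔
      CoarselySurjective f ∧ CoarselyConnectedFibres f := by
  constructor
  · rintro ⟨-, -, g, hg, ⟨S, hS, hfg⟩, hgf⟩
    refine ⟨⟨S, fun y => ⟨g y, hfg _ ⟨y, rfl⟩ _ (by simp) _ (by simp)⟩⟩, fun R => ?_⟩
    obtain ⟨r₁, s₁, hs₁, h₁⟩ := exists_joined_of_mem_lightStructure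
      (hg {U | ∀ x ∈ U, ∀ y ∈ U, dist x y ≤ max R 1} ⟨max R 1, by positivity, fun U hU => hU⟩)
    obtain ⟨r₂, s₂, hs₂, h₂⟩ := exists_joined_of_mem_lightStructure hgf
    -- The three chains live over balls of radii $s_2, s_1, s_2$ about $f(x)$, $f(gf(x))$,
    -- $f(gf(x'))$; the last centre is within $s_1 + s_2$ of $f(x)$.
    refine ⟨max r₁ r₂, s₂ + s₁ + s₂, fun x x' hd => ?_⟩
    have hpair : ({f x, f x'} : Set Y) ∈
        {U : Set Y | ∀ x ∈ U, ∀ y ∈ U, dist x y ≤ max R 1} := by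
      rintro p (rfl | rfl) q (rfl | rfl)
      · simp
      · exact hd.trans (le_max_left _ _)
      · rw [dist_comm]
        exact hd.trans (le_max_left _ _)
      · simp
    obtain ⟨d₁, j₁⟩ := h₂ _ ⟨x, rfl⟩ x (by simp) (g (f x)) (by simp)
    obtain ⟨d₂, j₂⟩ := h₁ _ ⟨_, hpair, rfl⟩ (g (f x)) ⟨_, by simp, rfl⟩ (g (f x')) ⟨_, by simp, rfl⟩
    obtain ⟨-, j₃⟩ := h₂ _ ⟨x', rfl⟩ (g (f x')) (by simp) x' (by simp)
    have t₁ := dist_triangle (f (g (f x'))) (f (g (f x))) (f x)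
    have c₁ := dist_comm (f (g (f x))) (f x)
    have c₂ := dist_comm (f (g (f x'))) (f (g (f x)))
    refine ((j₁.mono (le_max_right _ _) ?_).trans (j₂.mono (le_max_left _ _) ?_)).trans
      (j₃.mono (le_max_right _ _) ?_)
    · rw [dist_self]
      linarith
    · linarith
    · linarith
  · rintro ⟨⟨S, hS⟩, hc⟩
    choose g hg using hS
    refine ⟨hf, ?_, g, ?_, ?_, ?_⟩
    · intro ℬ hℬ
      obtain ⟨r, s, hs, h⟩ := exists_joined_of_mem_lightStructure hℬ
      refine ⟨s, hs, ?_⟩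
      rintro _ ⟨B, hB, rfl⟩ _ ⟨x, hx, rfl⟩ _ ⟨x', hx', rfl⟩
      exact (h B hB x hx x' hx').1
    · rintro 𝒰 ⟨M, hM, h𝒰⟩
      -- Approximate preimages of points at distance at most $M$ have images at distance at most $S
      -- + M + S$.
      obtain ⟨r, s, hrs⟩ := hc (S + M + S)
      refine mem_lightStructure_of_joined (r := r) (s := s) ?_
      rintro _ ⟨U, hU, rfl⟩ _ ⟨y, hy, rfl⟩ _ ⟨y', hy', rfl⟩
      refine hrs _ _ ((dist_triangle4 _ y y' _).trans ?_)
      rw [dist_comm y']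
      exact add_le_add (add_le_add (hg y) (h𝒰 U hU y hy y' hy')) (hg y')
    · refine ⟨max S 1, by positivity, ?_⟩
      rintro _ ⟨y, rfl⟩ a (rfl | rfl) b (rfl | rfl)
      · simp
      · exact (hg _).trans (le_max_left _ _)
      · rw [dist_comm]
        exact (hg _).trans (le_max_left _ _)
      · simp
    · obtain ⟨r, s, hrs⟩ := hc (max S 0)
      refine mem_lightStructure_of_joined (r := r) (s := s) ?_
      rintro _ ⟨x, rfl⟩ a (rfl | rfl) b (rfl | rfl)
      · exact Relation.ReflTransGen.refl
      · exact hrs _ _ ((hg _).trans (le_max_left _ _))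
      · refine hrs _ _ ?_
        rw [dist_comm]
        exact (hg _).trans (le_max_left _ _)
      · exact Relation.ReflTransGen.refl

/-! ### Separating asymptotically disjoint sets by slowly oscillating functions. -/

/-- Two sets are asymptotically disjoint if their uniform neighbourhoods have bounded
intersection. -/
def AsymptoticallyDisjoint (P Q : Set Y) : Prop :=
  ∀ R : ℝ, ∃ B : Set Y, IsBounded B ∧ ∀ p ∈ P, ∀ q ∈ Q, dist p q ≤ R → p ∈ B

/-- A point cannot be close to both $P$ and $Q$ unless it lies near a bounded set. Outside a bounded
set the denominator is therefore large, whereas both distances are $1$-Lipschitz. -/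
theorem AsymptoticallyDisjoint.slowlyOscillating {P Q : Set Y} (hP : P.Nonempty)
    (hQ : Q.Nonempty) (h : AsymptoticallyDisjoint P Q) :
    SlowlyOscillating fun y => ((Metric.infDist y P / (Metric.infDist y P + Metric.infDist y Q) :
      ℝ) : ℂ) := by
  intro R hR ε hε
  -- With denominator at least $T$, a displacement of $R$ changes the quotient by at most $R/T =
  -- \varepsilon$. A point within $T$ of both sets yields a pair at distance at most $T + T$.
  set T := R / ε with hT
  have hT0 : 0 < T := div_pos hR hε
  obtain ⟨B, hB, hBPQ⟩ := h (T + T)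
  refine ⟨Metric.cthickening T B, hB.cthickening, fun y hy y' hy' hd => ?_⟩
  have far : ∀ z ∉ Metric.cthickening T B, T ≤ Metric.infDist z P + Metric.infDist z Q := by
    intro z hz
    by_contra! hlt
    have hp0 := Metric.infDist_nonneg (x := z) (s := P)
    have hq0 := Metric.infDist_nonneg (x := z) (s := Q)
    obtain ⟨p, hp, hzp⟩ := (Metric.infDist_lt_iff (x := z) (r := T) hP).1 (by linarith)
    obtain ⟨q, hq, hzq⟩ := (Metric.infDist_lt_iff (x := z) (r := T) hQ).1 (by linarith)
    refine hz (Metric.mem_cthickening_of_dist_le z p T B (hBPQ p hp q hq ?_) hzp.le)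
    exact (dist_triangle_left p q z).trans (add_le_add hzp.le hzq.le)
  have h₁ := far y hy
  have h₂ := far y' hy'
  rw [← Complex.ofReal_sub, Complex.norm_real, Real.norm_eq_abs]
  have ea : |Metric.infDist y P - Metric.infDist y' P| ≤ R := by
    have e₁ := Metric.infDist_le_infDist_add_dist (x := y) (y := y') (s := P)
    have e₂ := Metric.infDist_le_infDist_add_dist (x := y') (y := y) (s := P)
    rw [dist_comm] at e₂
    rw [abs_le]
    constructor <;> linarith
  have eb : |Metric.infDist y' Q - Metric.infDist y Q| ≤ R := by
    have e₁ := Metric.infDist_le_infDist_add_dist (x := y) (y := y') (s := Q)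
    have e₂ := Metric.infDist_le_infDist_add_dist (x := y') (y := y) (s := Q)
    rw [dist_comm] at e₂
    rw [abs_le]
    constructor <;> linarith
  have a0 := Metric.infDist_nonneg (x := y) (s := P)
  have b0 := Metric.infDist_nonneg (x := y) (s := Q)
  set a := Metric.infDist y P
  set b := Metric.infDist y Q
  set a' := Metric.infDist y' P
  set b' := Metric.infDist y' Q
  have hD : 0 < a + b := by linarith
  have hD' : 0 < a' + b' := by linarith
  rw [div_sub_div _ _ hD.ne' hD'.ne', abs_div, abs_of_pos (mul_pos hD hD'),
    div_le_iff₀ (mul_pos hD hD')]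
  -- The weights $a$ and $b$ in this form add up to $a + b$, which cancels one of the two
  -- denominators.
  have e : a * (a' + b') - (a + b) * a' = a * (b' - b) + b * (a - a') := by ring
  rw [e]
  calc |a * (b' - b) + b * (a - a')| ≤ a * |b' - b| + b * |a - a'| := by
        refine (abs_add_le _ _).trans ?_
        rw [abs_mul, abs_mul, abs_of_nonneg a0, abs_of_nonneg b0]
    _ ≤ a * R + b * R := by gcongr
    _ = (a + b) * (ε * T) := by rw [hT]; field_simp
    _ ≤ (a + b) * (ε * (a' + b')) := by gcongr
    _ = ε * ((a + b) * (a' + b')) := by ring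

/-- For nonempty asymptotically disjoint sets there is a slowly oscillating function vanishing on
the first and eventually equal to one on the second. -/
theorem AsymptoticallyDisjoint.exists_function {P Q : Set Y} (hP : P.Nonempty)
    (hQ : Q.Nonempty) (h : AsymptoticallyDisjoint P Q) :
    ∃ g : SlowlyOscillatingFunctions Y, (∀ y ∈ P, g.1 y = 0) ∧
      ∃ B, IsBounded B ∧ ∀ y ∈ Q, y ∉ B → g.1 y = 1 := by
  have hb : ∀ y : Y, ‖((Metric.infDist y P / (Metric.infDist y P + Metric.infDist y Q) :
      ℝ) : ℂ)‖ ≤ 1 := fun y => by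
    have a0 := Metric.infDist_nonneg (x := y) (s := P)
    have b0 := Metric.infDist_nonneg (x := y) (s := Q)
    rw [Complex.norm_real, Real.norm_of_nonneg (by positivity)]
    exact div_le_one_of_le₀ (by linarith) (by linarith)
  refine ⟨(h.slowlyOscillating hP hQ).toFunctions _ ⟨1, hb⟩, fun y hy => ?_, ?_⟩
  · change ((_ : ℝ) : ℂ) = 0
    rw [Metric.infDist_zero_of_mem hy, zero_div, Complex.ofReal_zero]
  · obtain ⟨B, hB, hBPQ⟩ := h 1
    refine ⟨Metric.cthickening 1 B, hB.cthickening, fun y hy hyB => ?_⟩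
    change ((_ : ℝ) : ℂ) = 1
    rw [Metric.infDist_zero_of_mem hy, add_zero, div_self, Complex.ofReal_one]
    intro h0
    obtain ⟨p, hp, hyp⟩ := (Metric.infDist_lt_iff (x := y) (r := 1) hP).1 (by rw [h0]; exact one_pos)
    exact hyB (Metric.mem_cthickening_of_dist_le y p 1 B
      (hBPQ p hp y hy (by rw [dist_comm]; exact hyp.le)) hyp.le)

/-! ### Coarse maps and sequences at infinity. -/

theorem IsCoarseMap.isBounded_image (hf : IsCoarseMap (metricStructure X) (metricStructure Y) f)
    {B : Set X} (hB : IsBounded B) : IsBounded (f '' B) := by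
  obtain ⟨C, hC⟩ := Metric.isBounded_iff.1 hB
  obtain ⟨S, -, hS⟩ := hf.exists_dist_le (max C 1) (by positivity)
  refine Metric.isBounded_iff.2 ⟨S, ?_⟩
  rintro _ ⟨x, hx, rfl⟩ _ ⟨y, hy, rfl⟩
  exact hS x y ((hC hx hy).trans (le_max_left _ _))

theorem IsCoarseMap.tendsto_cobounded
    (hf : IsCoarseMap (metricStructure X) (metricStructure Y) f) :
    Tendsto f (cobounded X) (cobounded Y) := fun s hs => by
  rw [mem_map, ← isCobounded_def, ← isBounded_compl_iff]
  exact hf.isBounded_preimage (isBounded_compl_iff.2 (isCobounded_def.2 hs))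

/-- Since $f$ maps bounded sets to bounded sets, convergence to infinity in $X$ can be checked after
applying $f$. -/
theorem IsCoarseMap.comap_cobounded_le
    (hf : IsCoarseMap (metricStructure X) (metricStructure Y) f) :
    comap f (cobounded Y) ≤ cobounded X := fun s hs => by
  refine ⟨(f '' sᶜ)ᶜ, ?_, fun x hx => ?_⟩
  · exact isCobounded_def.1 (isCobounded_compl_iff.2
      (hf.isBounded_image (isBounded_compl_iff.2 (isCobounded_def.2 hs))))
  · by_contra hxs
    exact hx ⟨x, hxs, rfl⟩

/-- The reason why families at bounded distance that tend to infinity define the same point of the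
corona. -/
theorem SlowlyOscillating.tendsto_sub {g : Y → ℂ} (hg : SlowlyOscillating g) {ι : Type*}
    {l : Filter ι} {a b : ι → Y} (ha : Tendsto a l (cobounded Y)) (hb : Tendsto b l (cobounded Y))
    {R : ℝ} (hab : ∀ i, dist (a i) (b i) ≤ R) : Tendsto (fun i => g (a i) - g (b i)) l (𝓝 0) := by
  rw [Metric.tendsto_nhds]
  intro ε hε
  obtain ⟨B, hB, h⟩ := hg (max R 1) (by positivity) (ε / 2) (half_pos hε)
  have hB' : Bᶜ ∈ cobounded Y := isCobounded_def.1 (isCobounded_compl_iff.2 hB)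
  filter_upwards [ha hB', hb hB'] with i hai hbi
  rw [dist_zero_right]
  exact (h _ hai _ hbi ((hab i).trans (le_max_left _ _))).trans_lt (half_lt_self hε)

theorem tendsto_cobounded_of_dist_le {ι : Type*} {l : Filter ι} {a b : ι → Y}
    (ha : Tendsto a l (cobounded Y)) {R : ℝ} (hab : ∀ i, dist (a i) (b i) ≤ R) :
    Tendsto b l (cobounded Y) := fun s hs => by
  have hB : IsBounded (Metric.cthickening R sᶜ) :=
    (isBounded_compl_iff.2 (isCobounded_def.2 hs)).cthickening
  rw [mem_map]
  filter_upwards [ha.eventually_mem (isCobounded_def.1 (isCobounded_compl_iff.2 hB))] with i hi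
  by_contra his
  exact hi (Metric.mem_cthickening_of_dist_le _ _ _ _ his (hab i))

/-! ### From the coarse conditions to monotonicity of the corona map. -/

/-- A point of the corona of $Y$ is an ultrafilter limit; pushing the ultrafilter forward by a
choice $g$ of approximate preimages gives a preimage, because $f\circ g$ is at bounded distance from
the identity. -/
theorem CoarselySurjective.surjective_coronaMap
    (hf : IsCoarseMap (metricStructure X) (metricStructure Y) f) (hs : CoarselySurjective f) :
    Function.Surjective (coronaMap f hf) := by
  intro ψ
  obtain ⟨S, hS⟩ := hs
  choose g hg using hS
  obtain ⟨q, hq, hqg⟩ := ψ.exists_ultrafilter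
  have hfg : Tendsto (fun y => f (g y)) q (cobounded Y) :=
    tendsto_cobounded_of_dist_le (tendsto_id.mono_left hq) fun y => by
      rw [dist_comm]
      exact hg y
  have hp : ((q.map g : Ultrafilter X) : Filter X) ≤ cobounded X :=
    (map_le_iff_le_comap.1 (show map f (map g q) ≤ cobounded Y from hfg)).trans
      hf.comap_cobounded_le
  refine ⟨.ofUltrafilter _ hp, HigsonCorona.ext_eval fun k => ?_⟩
  rw [eval_coronaMap]
  have h₁ : Tendsto (fun y => k.1 (f (g y))) q
      (𝓝 ((HigsonCorona.ofUltrafilter _ hp).eval (pullback f hf k))) :=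
    HigsonCorona.tendsto_ofUltrafilter _ hp (pullback f hf k)
  have h₂ := SlowlyOscillating.tendsto_sub k.2 hfg (tendsto_id.mono_left hq) hg
  have h₃ := (hqg k).add h₂
  rw [add_zero] at h₃
  refine tendsto_nhds_unique h₁ (h₃.congr fun y => ?_)
  simp

/-- A discrete intermediate value theorem: steps that rise by at most $\beta - \alpha$ cannot jump
over $[\alpha, \beta]$. -/
theorem exists_mem_Icc_of_reflTransGen {X : Type*} {r : X → X → Prop} {h : X → ℝ} {α β : ℝ} {x x' : X}
    (hxx' : Relation.ReflTransGen r x x')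
    (hstep : ∀ a b, Relation.ReflTransGen r x a → r a b → h b ≤ h a + (β - α)) (hx : h x < α) :
    h x' < α ∨ ∃ z, Relation.ReflTransGen r x z ∧ α ≤ h z ∧ h z ≤ β := by
  induction hxx' with
  | refl => exact Or.inl hx
  | @tail a b hxa hab ih =>
    rcases ih with ha | hz
    · rcases lt_or_ge (h b) α with hb | hb
      · exact Or.inl hb
      · refine Or.inr ⟨b, hxa.tail hab, hb, ?_⟩
        have := hstep a b hxa hab
        linarith
    · exact Or.inr hz

theorem Joined.dist_le {r s : ℝ} {x x' : X} (hs : 0 ≤ s) (h : Joined f r s (f x) x x') :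
    dist (f x') (f x) ≤ s := by
  cases h with
  | refl => rwa [dist_self]
  | tail _ h => exact h.2.2

/-- Sets whose closures at infinity share a point of the corona after applying `f` have images
that are not asymptotically disjoint. -/
theorem not_asymptoticallyDisjoint_image
    (hf : IsCoarseMap (metricStructure X) (metricStructure Y) f) {φ ψ : HigsonCorona X}
    (hφψ : coronaMap f hf φ = coronaMap f hf ψ) {p q : Ultrafilter X}
    (hpφ : ∀ g, Tendsto (fun x => g.1 x) p (𝓝 (φ.eval g)))
    (hq : (q : Filter X) ≤ cobounded X)
    (hqψ : ∀ g, Tendsto (fun x => g.1 x) q (𝓝 (ψ.eval g))) {P Q : Set X} (hP : P ∈ p)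
    (hQ : Q ∈ q) : ¬ AsymptoticallyDisjoint (f '' P) (f '' Q) := by
  intro hd
  obtain ⟨e, he₀, B, hB, he₁⟩ := hd.exists_function ((Ultrafilter.nonempty_of_mem hP).image f)
    ((Ultrafilter.nonempty_of_mem hQ).image f)
  have h₀ : φ.eval (pullback f hf e) = 0 := by
    refine tendsto_nhds_unique (hpφ _) (tendsto_const_nhds.congr' ?_)
    filter_upwards [hP] with x hx
    exact (he₀ _ ⟨x, hx, rfl⟩).symm
  have h₁ : ψ.eval (pullback f hf e) = 1 := by
    refine tendsto_nhds_unique (hqψ _) (tendsto_const_nhds.congr' ?_)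
    filter_upwards [hQ, hq (hf.tendsto_cobounded
      (isCobounded_def.1 (isCobounded_compl_iff.2 hB)))] with x hx hxB
    exact (he₁ _ ⟨x, hx, rfl⟩ hxB).symm
  rw [← eval_coronaMap, hφψ, eval_coronaMap, h₁] at h₀
  exact one_ne_zero h₀

/-- A splitting of the fibre gives $h$ on $X$ separating the pieces, and $k$ on $Y$ separating $y$
from the image of the region where $h$ is in $[1/3, 2/3]$. Points of $X$ with $h$ in that range and
$k\circ f$ small then form a bounded set, yet chains joining the two pieces must meet it arbitrarily
far out. -/
theorem CoarselyConnectedFibres.isPreconnected_fibre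
    (hf : IsCoarseMap (metricStructure X) (metricStructure Y) f) (hc : CoarselyConnectedFibres f)
    (y : HigsonCorona Y) : IsPreconnected (coronaMap f hf ⁻¹' {y}) := by
  rw [isPreconnected_closed_iff]
  rintro t t' ht ht' hcov ⟨a, hay, hat⟩ ⟨b, hby, hbt⟩
  by_contra hemp
  have hF : IsClosed (coronaMap f hf ⁻¹' {y}) :=
    isClosed_singleton.preimage (coronaMap f hf).continuous
  obtain ⟨h, h₀, h₁⟩ := exists_separating (hF.inter ht) (hF.inter ht')
    (Set.disjoint_left.2 fun φ h h' => hemp ⟨φ, h.1, h.2, h'.2⟩)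
  have hre : Continuous fun φ : HigsonCorona X => (φ.eval h).re :=
    Complex.continuous_re.comp (HigsonCorona.continuous_eval h)
  have hK : IsClosed {φ : HigsonCorona X | 1 / 3 ≤ (φ.eval h).re ∧ (φ.eval h).re ≤ 2 / 3} :=
    (isClosed_le continuous_const hre).inter (isClosed_le hre continuous_const)
  obtain ⟨k, k₀, k₁⟩ := exists_separating (isClosed_singleton (x := y))
    (hK.isCompact.image (coronaMap f hf).continuous).isClosed (by
      rw [Set.disjoint_singleton_left]
      rintro ⟨φ, ⟨hφ, hφ'⟩, hφy⟩
      rcases hcov hφy with hφt | hφt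
      · have := h₀ φ ⟨hφy, hφt⟩
        linarith
      · have := h₁ φ ⟨hφy, hφt⟩
        linarith)
  have hre_tendsto : ∀ {p : Ultrafilter X} {φ : HigsonCorona X},
      (∀ g, Tendsto (fun x => g.1 x) p (𝓝 (φ.eval g))) → ∀ g,
      Tendsto (fun x => (g.1 x).re) p (𝓝 (φ.eval g).re) := fun hp g =>
    (Complex.continuous_re.tendsto _).comp (hp g)
  -- the middle region on which `k ∘ f` is small is bounded
  have hZ : IsBounded {x | 1 / 3 ≤ (h.1 x).re ∧ (h.1 x).re ≤ 2 / 3 ∧ (k.1 (f x)).re ≤ 2 / 3} := by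
    by_contra hZ
    obtain ⟨p, hp, hZp⟩ := exists_ultrafilter_of_unbounded hZ
    have lim := hre_tendsto (HigsonCorona.tendsto_ofUltrafilter p hp)
    have e₁ := ge_of_tendsto (lim h) (by filter_upwards [hZp] with x hx using hx.1)
    have e₂ := le_of_tendsto (lim h) (by filter_upwards [hZp] with x hx using hx.2.1)
    have e₃ := le_of_tendsto (lim (pullback f hf k))
      (by filter_upwards [hZp] with x hx using hx.2.2)
    have := k₁ _ ⟨_, ⟨e₁, e₂⟩, rfl⟩
    rw [eval_coronaMap] at this
    linarith
  have hka : (a.eval (pullback f hf k)).re < 1 / 4 := by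
    rw [← eval_coronaMap]
    exact k₀ _ hay
  have ha := h₀ a ⟨hay, hat⟩
  have hb := h₁ b ⟨hby, hbt⟩
  obtain ⟨p, hp, hpa⟩ := a.exists_ultrafilter
  obtain ⟨q, hq, hqb⟩ := b.exists_ultrafilter
  have hP : {x | (h.1 x).re < 1 / 3 ∧ (k.1 (f x)).re < 1 / 3} ∈ p :=
    inter_mem ((hre_tendsto hpa h).eventually_lt_const (by linarith))
      ((hre_tendsto hpa (pullback f hf k)).eventually_lt_const (by linarith))
  have hQ : {x | 2 / 3 < (h.1 x).re} ∈ q :=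
    (hre_tendsto hqb h).eventually_const_lt (by linarith)
  have hnd := not_asymptoticallyDisjoint_image hf (Set.mem_singleton_iff.1 hay |>.trans
    (Set.mem_singleton_iff.1 hby).symm) hpa hq hqb hP hQ
  simp only [AsymptoticallyDisjoint, not_forall, not_exists, not_and] at hnd
  obtain ⟨R, hR⟩ := hnd
  obtain ⟨r, s, hrs⟩ := hc R
  obtain ⟨B₁, hB₁, hh⟩ := h.2 (max r 1) (by positivity) (1 / 3) (by norm_num)
  obtain ⟨B₂, hB₂, hk⟩ := k.2 (max s 1) (by positivity) (1 / 3) (by norm_num)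
  -- The pair is chosen with $f(x)$ so far out that every point of a chain over the ball of radius
  -- `max s 1` about $f(x)$ avoids all three exceptional sets.
  obtain ⟨_, ⟨x, hxP, rfl⟩, _, ⟨x', hx'Q, rfl⟩, hxx', hfar⟩ :=
    hR _ (((hf.isBounded_image (hB₁.union hZ)).union hB₂).cthickening (δ := max s 1))
  have hj : Joined f r (max s 1) (f x) x x' :=
    (hrs x x' hxx').mono le_rfl (by rw [dist_self, add_zero]; exact le_max_left _ _)
  have hch : ∀ z, Joined f r (max s 1) (f x) x z → z ∉ B₁ ∧
      ¬ (1 / 3 ≤ (h.1 z).re ∧ (h.1 z).re ≤ 2 / 3 ∧ (k.1 (f z)).re ≤ 2 / 3) ∧ f z ∉ B₂ := by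
    intro z hz
    have hd := hz.dist_le (by positivity)
    rw [dist_comm] at hd
    have hn := fun hmem => hfar (Metric.mem_cthickening_of_dist_le (f x) (f z) (max s 1) _ hmem hd)
    exact ⟨fun hz => hn (Or.inl ⟨z, Or.inl hz, rfl⟩), fun hz => hn (Or.inl ⟨z, Or.inr hz, rfl⟩),
      fun hz => hn (Or.inr hz)⟩
  have hx := hch x Relation.ReflTransGen.refl
  have hstep : ∀ a b, Joined f r (max s 1) (f x) x a →
      (dist a b ≤ r ∧ dist (f a) (f x) ≤ max s 1 ∧ dist (f b) (f x) ≤ max s 1) →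
      (h.1 b).re ≤ (h.1 a).re + (2 / 3 - 1 / 3) := by
    intro a b ha hab
    have e := (Complex.abs_re_le_norm _).trans
      (hh b (hch b (ha.tail hab)).1 a (hch a ha).1
        (by rw [dist_comm]; exact hab.1.trans (le_max_left _ _)))
    rw [Complex.sub_re, abs_le] at e
    linarith
  rcases exists_mem_Icc_of_reflTransGen hj hstep hxP.1 with hlt | ⟨z, hz, hz₁, hz₂⟩
  · have : 2 / 3 < (h.1 x').re := hx'Q
    linarith
  · have hzc := hch z hz
    -- Along the chain $k\circ f$ stays within $1/3$ of its value at $x$, which is below $1/3$, so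
    -- $z$ lies in the excluded middle region.
    refine hzc.2.1 ⟨hz₁, hz₂, ?_⟩
    have e := (Complex.abs_re_le_norm _).trans
      (hk (f z) hzc.2.2 (f x) hx.2.2 (Joined.dist_le (by positivity) hz))
    rw [Complex.sub_re, abs_le] at e
    have : (k.1 (f x)).re < 1 / 3 := hxP.2
    linarith

/-! ### Surjectivity of the corona map forces coarse surjectivity. -/

/-- Otherwise there are points $y_n$ at distance more than $n$ from the image. They form an
unbounded set asymptotically disjoint from the image, and a limit of them at infinity has no
preimage. Nonemptiness matters: for empty $X$ and bounded nonempty $Y$ both coronas are empty. -/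
theorem coarselySurjective_of_surjective_coronaMap [Nonempty X]
    (hf : IsCoarseMap (metricStructure X) (metricStructure Y) f)
    (hs : Function.Surjective (coronaMap f hf)) : CoarselySurjective f := by
  by_contra hns
  simp only [CoarselySurjective, not_exists, not_forall, not_le] at hns
  choose y hy using fun n : ℕ => hns n
  obtain ⟨x₀⟩ := ‹Nonempty X›
  have hd : AsymptoticallyDisjoint (Set.range f) (Set.range y) := by
    intro R
    obtain ⟨N, hN⟩ := exists_nat_ge R
    refine ⟨⋃ n ∈ Finset.range N, Metric.closedBall (y n) R,
      (isBounded_biUnion_finset _).2 fun n _ => Metric.isBounded_closedBall, ?_⟩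
    rintro _ ⟨x, rfl⟩ _ ⟨n, rfl⟩ hxn
    have : (n : ℝ) < N := ((hy n x).trans_le hxn).trans_le hN
    exact Set.mem_biUnion (Finset.mem_coe.2 (Finset.mem_range.2 (by exact_mod_cast this))) hxn
  obtain ⟨e, he₀, B, hB, he₁⟩ := hd.exists_function (Set.range_nonempty f) (Set.range_nonempty y)
  have hunb : ¬ IsBounded (Set.range y) := by
    intro hb
    obtain ⟨C, hC⟩ := hb.subset_closedBall (f x₀)
    obtain ⟨N, hN⟩ := exists_nat_ge C
    have h₁ : dist (y N) (f x₀) ≤ C := hC ⟨N, rfl⟩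
    rw [dist_comm] at h₁
    linarith [hy N x₀]
  obtain ⟨q, hq, hyq⟩ := exists_ultrafilter_of_unbounded hunb
  obtain ⟨φ, hφ⟩ := hs (.ofUltrafilter q hq)
  obtain ⟨p, -, hpφ⟩ := φ.exists_ultrafilter
  have h₀ : φ.eval (pullback f hf e) = 0 :=
    tendsto_nhds_unique (hpφ _) (tendsto_const_nhds.congr fun x => (he₀ _ ⟨x, rfl⟩).symm)
  have h₁ : (HigsonCorona.ofUltrafilter q hq).eval e = 1 := by
    refine tendsto_nhds_unique (HigsonCorona.tendsto_ofUltrafilter q hq e)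
      (tendsto_const_nhds.congr' ?_)
    filter_upwards [hyq, hq (isCobounded_def.1 (isCobounded_compl_iff.2 hB))] with z hz hzB
    exact (he₁ _ hz hzB).symm
  rw [← hφ, eval_coronaMap, h₀] at h₁
  exact zero_ne_one h₁

/-! ### Connected fibres of the corona map force coarsely connected fibres. -/

/-- The value of a sum of functions with disjoint supports. -/
theorem tsum_eq_of_disjoint {X : Type*} {v : ℕ → X → ℝ}
    (hdisj : ∀ x i j, v i x ≠ 0 → v j x ≠ 0 → i = j) {x : X} {i : ℕ} (hi : v i x ≠ 0) :
    ∑' n, v n x = v i x :=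
  tsum_eq_single i fun j hj => by
    by_contra h
    exact hj (hdisj x j i h hi)

/-- For given $R$ and $\varepsilon$ only finitely many terms oscillate too much, and their supports
form a bounded set; elsewhere at most one term is nonzero at each point. -/
theorem slowlyOscillating_tsum {v : ℕ → X → ℝ} (hnonneg : ∀ n x, 0 ≤ v n x)
    (hdisj : ∀ x i j, v i x ≠ 0 → v j x ≠ 0 → i = j)
    (hsupp : ∀ n, IsBounded (Function.support (v n)))
    (hosc : ∀ R : ℝ, 0 < R → ∀ ε : ℝ, 0 < ε → ∃ N : ℕ, ∀ n ≥ N, ∀ x x', dist x x' ≤ R →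
      |v n x - v n x'| ≤ ε) :
    SlowlyOscillating fun x => ((∑' n, v n x : ℝ) : ℂ) := by
  intro R hR ε hε
  obtain ⟨N, hN⟩ := hosc R hR ε hε
  refine ⟨⋃ n ∈ Finset.range N, Function.support (v n),
    (isBounded_biUnion_finset _).2 fun n _ => hsupp n, ?_⟩
  -- A one-sided bound suffices by symmetry. It compares only the term alive at $x$; a different
  -- term alive at $x'$ does no harm because all terms are nonnegative.
  have key : ∀ x ∉ ⋃ n ∈ Finset.range N, Function.support (v n), ∀ x', dist x x' ≤ R →
      ∑' n, v n x ≤ ∑' n, v n x' + ε := by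
    intro x hx x' hd
    have h0 : 0 ≤ ∑' n, v n x' := tsum_nonneg fun n => hnonneg n x'
    by_cases hz : ∀ n, v n x = 0
    · simp only [hz, tsum_zero]
      linarith
    · push Not at hz
      obtain ⟨i, hi⟩ := hz
      have hiN : N ≤ i := by
        by_contra! hlt
        exact hx (Set.mem_biUnion (Finset.mem_coe.2 (Finset.mem_range.2 hlt)) hi)
      rw [tsum_eq_of_disjoint hdisj hi]
      have h₁ := (abs_le.1 (hN i hiN x x' hd)).2
      have h₂ : v i x' ≤ ∑' n, v n x' := by
        by_cases h : v i x' = 0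
        · rwa [h]
        · exact (tsum_eq_of_disjoint hdisj h).ge
      linarith
  intro x hx x' hx' hd
  rw [← Complex.ofReal_sub, Complex.norm_real, Real.norm_eq_abs, abs_le]
  have h₁ := key x hx x' hd
  have h₂ := key x' hx' x (by rwa [dist_comm])
  constructor <;> linarith

theorem norm_tsum_le_one {X : Type*} {v : ℕ → X → ℝ} (hnonneg : ∀ n x, 0 ≤ v n x)
    (hle : ∀ n x, v n x ≤ 1) (hdisj : ∀ x i j, v i x ≠ 0 → v j x ≠ 0 → i = j) (x : X) :
    ‖((∑' n, v n x : ℝ) : ℂ)‖ ≤ 1 := by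
  rw [Complex.norm_real, Real.norm_of_nonneg (tsum_nonneg fun n => hnonneg n x)]
  by_cases hz : ∀ n, v n x = 0
  · simp [hz]
  · push Not at hz
    obtain ⟨i, hi⟩ := hz
    rw [tsum_eq_of_disjoint hdisj hi]
    exact hle i x

/-- The tent function of height one on the ball of radius `k` about `c`. -/
noncomputable def tent (c : Y) (k : ℝ) (y : Y) : ℝ :=
  max 0 (1 - dist y c / k)

theorem tent_nonneg (c : Y) (k : ℝ) (y : Y) : 0 ≤ tent c k y := le_max_left _ _

theorem tent_le_one (c : Y) {k : ℝ} (hk : 0 < k) (y : Y) : tent c k y ≤ 1 := by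
  have : 0 ≤ dist y c / k := by positivity
  exact max_le zero_le_one (by linarith)

theorem tent_self (c : Y) (k : ℝ) : tent c k c = 1 := by simp [tent]

theorem dist_lt_of_tent_ne_zero {c : Y} {k : ℝ} (hk : 0 < k) {y : Y} (h : tent c k y ≠ 0) :
    dist y c < k := by
  by_contra! hle
  refine h (max_eq_left ?_)
  have := (one_le_div hk).2 hle
  linarith

theorem abs_tent_sub_le (c : Y) {k : ℝ} (hk : 0 < k) (y y' : Y) :
    |tent c k y - tent c k y'| ≤ dist y y' / k := by
  rw [tent, tent, max_comm 0, max_comm 0]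
  refine (abs_max_sub_max_le_abs _ _ _).trans ?_
  have e : 1 - dist y c / k - (1 - dist y' c / k) = (dist y' c - dist y c) / k := by ring
  rw [e, abs_div, abs_of_pos hk, dist_comm y y']
  gcongr
  exact abs_dist_sub_le y' y c

/-- The tent function over the target, cut down to a chain component of the preimage of its
supporting ball. -/
noncomputable def componentTent (f : X → Y) (x₀ : X) (k : ℝ) : X → ℝ :=
  {x | Joined f k k (f x₀) x₀ x}.indicator fun x => tent (f x₀) k (f x)

theorem tent_ne_zero_of_componentTent {x₀ x : X} {k : ℝ} (h : componentTent f x₀ k x ≠ 0) :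
    tent (f x₀) k (f x) ≠ 0 ∧ componentTent f x₀ k x = tent (f x₀) k (f x) := by
  have hx := Set.mem_of_indicator_ne_zero h
  have e : componentTent f x₀ k x = tent (f x₀) k (f x) := Set.indicator_of_mem hx _
  exact ⟨e ▸ h, e⟩

/-- Cutting off costs no oscillation at scale $k$: if only one of the two points lies in the
component, one of the tents vanishes, since otherwise the step between them would stay over the ball
and extend the chain. -/
theorem abs_componentTent_sub_le {x₀ x x' : X} {k : ℝ} (hk : 0 < k) (hd : dist x x' ≤ k) :
    |componentTent f x₀ k x - componentTent f x₀ k x'| ≤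
      |tent (f x₀) k (f x) - tent (f x₀) k (f x')| := by
  have key : ∀ a b, dist a b ≤ k → Joined f k k (f x₀) x₀ a → ¬ Joined f k k (f x₀) x₀ b →
      tent (f x₀) k (f a) = 0 ∨ tent (f x₀) k (f b) = 0 := by
    intro a b hab ha hb
    by_contra! h
    exact hb (ha.tail ⟨hab, (dist_lt_of_tent_ne_zero hk h.1).le,
      (dist_lt_of_tent_ne_zero hk h.2).le⟩)
  by_cases hx : Joined f k k (f x₀) x₀ x <;> by_cases hx' : Joined f k k (f x₀) x₀ x'
  · exact le_of_eq (by simp [componentTent, hx, hx'])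
  · rcases key x x' hd hx hx' with h | h <;> simp [componentTent, hx, hx', h]
  · rcases key x' x (by rwa [dist_comm]) hx' hx with h | h <;> simp [componentTent, hx, hx', h]
  · simp [componentTent, hx, hx']

/-- Bad pairs exist arbitrarily far out: a pair over a bounded region lies in a set of some diameter
$M$, and is joined by a single step as soon as steps of size $M$ are allowed. -/
theorem exists_not_joined (hf : IsCoarseMap (metricStructure X) (metricStructure Y) f) {R : ℝ}
    (hR : ∀ r s, ∃ x x', dist (f x) (f x') ≤ R ∧ ¬ Joined f r s (f x) x x') (k : ℝ) {B : Set Y}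
    (hB : IsBounded B) :
    ∃ x x', dist (f x) (f x') ≤ R ∧ ¬ Joined f k k (f x) x x' ∧ f x ∉ B := by
  obtain ⟨M, hM⟩ := Metric.isBounded_iff.1 (hf.isBounded_preimage (hB.cthickening (δ := max R 0)))
  obtain ⟨x, x', hd, hj⟩ := hR (max k M) (max k (max R 0))
  refine ⟨x, x', hd, fun h => hj (h.mono (le_max_left _ _) ?_), fun hxB => hj ?_⟩
  · rw [dist_self, add_zero]
    exact le_max_left _ _
  · have h₁ : f x ∈ Metric.cthickening (max R 0) B := Metric.self_subset_cthickening _ hxB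
    have h₂ : f x' ∈ Metric.cthickening (max R 0) B :=
      Metric.mem_cthickening_of_dist_le _ (f x) _ _ hxB
        (by rw [dist_comm]; exact hd.trans (le_max_left _ _))
    refine Relation.ReflTransGen.single ⟨(hM h₁ h₂).trans (le_max_right _ _), ?_, ?_⟩
    · rw [dist_self]
      positivity
    · rw [dist_comm]
      exact hd.trans ((le_max_left _ _).trans (le_max_right _ _))

/-- If the fibres are not coarsely connected, there is a sparse sequence of pairs of points of
growing scale which are not joined at that scale. -/
theorem exists_seq_not_joined (hf : IsCoarseMap (metricStructure X) (metricStructure Y) f) {R : ℝ}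
    (hR : ∀ r s, ∃ x x', dist (f x) (f x') ≤ R ∧ ¬ Joined f r s (f x) x x') :
    ∃ (k : ℕ → ℝ) (x x' : ℕ → X), (∀ n : ℕ, (n : ℝ) + 1 ≤ k n) ∧
      (∀ n, dist (f (x n)) (f (x' n)) ≤ R) ∧
      (∀ n, ¬ Joined f (k n) (k n) (f (x n)) (x n) (x' n)) ∧
      ∀ m n : ℕ, m ≠ n → k m + k n ≤ dist (f (x m)) (f (x n)) := by
  obtain ⟨t, ht, htt⟩ := exists_seq_of_forall_finset_exists
    (fun t : ℝ × X × X => 1 ≤ t.1 ∧ dist (f t.2.1) (f t.2.2) ≤ R ∧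
      ¬ Joined f t.1 t.1 (f t.2.1) t.2.1 t.2.2)
    (fun t t' => t.1 + 1 ≤ t'.1 ∧ t.1 + t'.1 ≤ dist (f t.2.1) (f t'.2.1)) (by
      intro s hs
      obtain ⟨K, hK⟩ := (s.image fun t => t.1 + 1).finite_toSet.bddAbove
      obtain ⟨x, x', hd, hj, hB⟩ := exists_not_joined hf hR (max K 1)
        (B := ⋃ t ∈ s, Metric.closedBall (f t.2.1) (t.1 + max K 1))
        ((isBounded_biUnion_finset _).2 fun _ _ => Metric.isBounded_closedBall)
      -- The new scale exceeds each earlier one by at least $1$, and $f(x)$ avoids the balls that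
      -- would break the required separation.
      refine ⟨(max K 1, x, x'), ⟨le_max_right _ _, hd, hj⟩, fun t ht => ⟨?_, ?_⟩⟩
      · exact (hK (Finset.mem_coe.2 (Finset.mem_image_of_mem _ ht))).trans (le_max_left _ _)
      · by_contra! hlt
        refine hB (Set.mem_biUnion (Finset.mem_coe.2 ht) ?_)
        rw [Metric.mem_closedBall, dist_comm]
        exact hlt.le)
  refine ⟨fun n => (t n).1, fun n => (t n).2.1, fun n => (t n).2.2, fun n => ?_,
    fun n => (ht n).2.1, fun n => (ht n).2.2, fun m n hmn => ?_⟩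
  · induction n with
    | zero => simpa using (ht 0).1
    | succ n ih =>
      have := (htt n (n + 1) n.lt_succ_self).1
      push_cast
      linarith
  · rcases hmn.lt_or_gt with h | h
    · exact (htt m n h).2
    · rw [add_comm, dist_comm]
      exact (htt n m h).2

/-- Sparse unjoined pairs yield a slowly oscillating $h$ that behaves like an idempotent on one
fibre and is nonconstant there. -/
theorem coarselyConnectedFibres_of_isPreconnected
    (hf : IsCoarseMap (metricStructure X) (metricStructure Y) f)
    (hc : ∀ y, IsPreconnected (coronaMap f hf ⁻¹' {y})) : CoarselyConnectedFibres f := by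
  by_contra hn
  simp only [CoarselyConnectedFibres, not_forall, not_exists] at hn
  obtain ⟨R, hR⟩ := hn
  obtain ⟨k, x, x', hk, hxx', hj, hsep⟩ := exists_seq_not_joined hf (R := R) fun r s => by
    obtain ⟨x, x', hd, h⟩ := hR r s
    exact ⟨x, x', hd, h⟩
  have hk0 : ∀ n, 0 < k n := fun n => lt_of_lt_of_le (by positivity) (hk n)
  -- the sequences tend to infinity
  have hfx : Tendsto (fun n => f (x n)) atTop (cobounded Y) := by
    rw [← Metric.comap_dist_left_atTop (f (x 0)), tendsto_comap_iff]
    refine tendsto_atTop_mono' _ ?_ tendsto_natCast_atTop_atTop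
    filter_upwards [eventually_ne_atTop 0] with n hn
    have := hsep 0 n hn.symm
    simp only [Function.comp_apply]
    linarith [hk n, hk0 0]
  have hfx' : Tendsto (fun n => f (x' n)) atTop (cobounded Y) :=
    tendsto_cobounded_of_dist_le hfx hxx'
  have hω : (hyperfilter ℕ : Filter ℕ) ≤ atTop := Nat.hyperfilter_le_atTop
  have hinf : ∀ z : ℕ → X, Tendsto (fun n => f (z n)) atTop (cobounded Y) →
      (((hyperfilter ℕ).map z : Ultrafilter X) : Filter X) ≤ cobounded X := fun z hz =>
    (map_le_iff_le_comap.1 (show map f (map z _) ≤ cobounded Y from hz.mono_left hω)).trans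
      hf.comap_cobounded_le
  -- the tent functions on the target
  let u : ℕ → Y → ℝ := fun n => tent (f (x n)) (k n)
  have hu_disj : ∀ y i j, u i y ≠ 0 → u j y ≠ 0 → i = j := by
    intro y i j hi hj
    by_contra hij
    have h₁ := dist_lt_of_tent_ne_zero (hk0 i) hi
    have h₂ := dist_lt_of_tent_ne_zero (hk0 j) hj
    have h₃ := dist_triangle_left (f (x i)) (f (x j)) y
    linarith [hsep i j hij]
  have hu_supp : ∀ n, Function.support (u n) ⊆ Metric.closedBall (f (x n)) (k n) :=
    fun n y hy => (dist_lt_of_tent_ne_zero (hk0 n) hy).le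
  have hu_osc : ∀ S : ℝ, 0 < S → ∀ ε : ℝ, 0 < ε → ∃ N : ℕ, ∀ n ≥ N, ∀ y y', dist y y' ≤ S →
      |u n y - u n y'| ≤ ε := by
    intro S hS ε hε
    obtain ⟨N, hN⟩ := exists_nat_ge (S / ε)
    refine ⟨N, fun n hn y y' hd => (abs_tent_sub_le _ (hk0 n) y y').trans ?_⟩
    rw [div_le_iff₀ (hk0 n)]
    rw [div_le_iff₀' hε] at hN
    have : (N : ℝ) ≤ n := by exact_mod_cast hn
    exact hd.trans (hN.trans (mul_le_mul_of_nonneg_left (by linarith [hk n]) hε.le))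
  let g : SlowlyOscillatingFunctions Y :=
    (slowlyOscillating_tsum (fun n y => tent_nonneg _ _ y) hu_disj
      (fun n => Metric.isBounded_closedBall.subset (hu_supp n)) hu_osc).toFunctions _
      ⟨1, norm_tsum_le_one (fun n y => tent_nonneg _ _ y) (fun n => tent_le_one _ (hk0 n)) hu_disj⟩
  -- the tent functions cut down to components
  let v : ℕ → X → ℝ := fun n => componentTent f (x n) (k n)
  have hv : ∀ n z, v n z ≠ 0 → u n (f z) ≠ 0 ∧ v n z = u n (f z) := fun n z =>
    tent_ne_zero_of_componentTent
  have hv0 : ∀ n z, 0 ≤ v n z := fun n =>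
    Set.indicator_nonneg fun z _ => tent_nonneg _ _ (f z)
  have hv1 : ∀ n z, v n z ≤ 1 := fun n z => by
    by_cases h : v n z = 0
    · rw [h]
      exact zero_le_one
    · rw [(hv n z h).2]
      exact tent_le_one _ (hk0 n) _
  have hv_disj : ∀ z i j, v i z ≠ 0 → v j z ≠ 0 → i = j := fun z i j hi hj =>
    hu_disj (f z) i j (hv i z hi).1 (hv j z hj).1
  have hv_osc : ∀ S : ℝ, 0 < S → ∀ ε : ℝ, 0 < ε → ∃ N : ℕ, ∀ n ≥ N, ∀ z z', dist z z' ≤ S →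
      |v n z - v n z'| ≤ ε := by
    intro S hS ε hε
    obtain ⟨T, hT, hST⟩ := hf.exists_dist_le S hS
    obtain ⟨N, hN⟩ := hu_osc T hT ε hε
    obtain ⟨M, hM⟩ := exists_nat_ge S
    refine ⟨max N M, fun n hn z z' hd => (abs_componentTent_sub_le (hk0 n) ?_).trans
      (hN n (le_of_max_le_left hn) _ _ (hST z z' hd))⟩
    have : (M : ℝ) ≤ n := by exact_mod_cast le_of_max_le_right hn
    linarith [hk n]
  let h : SlowlyOscillatingFunctions X :=
    (slowlyOscillating_tsum hv0 hv_disj (fun n => (hf.isBounded_preimage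
      (Metric.isBounded_closedBall (x := f (x n)) (r := k n))).subset
        fun z hz => hu_supp n (hv n z hz).1) hv_osc).toFunctions _
      ⟨1, norm_tsum_le_one hv0 hv1 hv_disj⟩
  have hg_apply : ∀ y, g.1 y = ((∑' n, u n y : ℝ) : ℂ) := fun _ => rfl
  have hh_apply : ∀ z, h.1 z = ((∑' n, v n z : ℝ) : ℂ) := fun _ => rfl
  have hux : ∀ n, u n (f (x n)) = 1 := fun n => tent_self _ _
  have hvx : ∀ n, v n (x n) = 1 := fun n =>
    (Set.indicator_of_mem (show x n ∈ {z | Joined f (k n) (k n) (f (x n)) (x n) z} from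
      Relation.ReflTransGen.refl) _).trans (tent_self _ _)
  have hgx : ∀ n, g.1 (f (x n)) = 1 := fun n => by
    rw [hg_apply, tsum_eq_of_disjoint hu_disj (i := n) (by rw [hux]; exact one_ne_zero), hux,
      Complex.ofReal_one]
  have hhx : ∀ n, h.1 (x n) = 1 := fun n => by
    rw [hh_apply, tsum_eq_of_disjoint hv_disj (i := n) (by rw [hvx]; exact one_ne_zero), hvx,
      Complex.ofReal_one]
  -- The $n$-th term vanishes at $x_n'$ because the pair is not joined; any other term does once
  -- $k_n > R$, as $f(x_n')$ is then too close to $f(x_n)$ to reach another tent.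
  have hhx' : ∀ᶠ n in atTop, h.1 (x' n) = 0 := by
    obtain ⟨N, hN⟩ := exists_nat_ge R
    filter_upwards [eventually_ge_atTop N] with n hn
    have hvz : ∀ m, v m (x' n) = 0 := by
      intro m
      by_contra hm
      by_cases hmn : m = n
      · subst hmn
        exact hj m (Set.mem_of_indicator_ne_zero hm)
      · have h₁ := dist_lt_of_tent_ne_zero (hk0 m) (hv m _ hm).1
        have h₂ := dist_triangle_left (f (x m)) (f (x n)) (f (x' n))
        have h₃ := hxx' n
        rw [dist_comm] at h₃
        have : (N : ℝ) ≤ n := by exact_mod_cast hn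
        linarith [hsep m n hmn, hk n]
    rw [hh_apply]
    simp [hvz]
  -- Where $h$ is nonzero, its single nonzero term is the uncut tent, which is also the only nonzero
  -- term of $g\circ f$.
  have hmul : h * (h - pullback f hf g) = 0 := by
    refine Subtype.ext (lp.ext (funext fun z => ?_))
    change h.1 z * (h.1 z - g.1 (f z)) = 0
    by_cases hz : ∀ n, v n z = 0
    · rw [hh_apply]
      simp [hz]
    · push Not at hz
      obtain ⟨i, hi⟩ := hz
      rw [hh_apply, hg_apply, tsum_eq_of_disjoint hv_disj hi,
        tsum_eq_of_disjoint hu_disj (hv i z hi).1, (hv i z hi).2, sub_self, mul_zero]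
  let φ := HigsonCorona.ofUltrafilter _ (hinf x hfx)
  let φ' := HigsonCorona.ofUltrafilter _ (hinf x' hfx')
  have lim : ∀ e : SlowlyOscillatingFunctions X,
      Tendsto (fun n => e.1 (x n)) (hyperfilter ℕ) (𝓝 (φ.eval e)) :=
    HigsonCorona.tendsto_ofUltrafilter _ (hinf x hfx)
  have lim' : ∀ e : SlowlyOscillatingFunctions X,
      Tendsto (fun n => e.1 (x' n)) (hyperfilter ℕ) (𝓝 (φ'.eval e)) :=
    HigsonCorona.tendsto_ofUltrafilter _ (hinf x' hfx')
  -- Both limits use the same ultrafilter on the indices, so the bounded distance between $f(x_n)$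
  -- and $f(x_n')$ identifies the images.
  have heq : coronaMap f hf φ' = coronaMap f hf φ := by
    refine HigsonCorona.ext_eval fun e => ?_
    rw [eval_coronaMap, eval_coronaMap, ← sub_eq_zero, ← neg_sub, neg_eq_zero]
    exact tendsto_nhds_unique ((lim _).sub (lim' _))
      ((SlowlyOscillating.tendsto_sub e.2 hfx hfx' hxx').mono_left hω)
  have hφh : φ.eval h = 1 :=
    tendsto_nhds_unique (lim h) (tendsto_const_nhds.congr fun n => (hhx n).symm)
  have hφ'h : φ'.eval h = 0 :=
    tendsto_nhds_unique (lim' h) (tendsto_const_nhds.congr' (by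
      filter_upwards [hω hhx'] with n hn using hn.symm))
  have hφg : φ.eval (pullback f hf g) = 1 :=
    tendsto_nhds_unique (lim _) (tendsto_const_nhds.congr fun n => (hgx n).symm)
  have hpre := (hc (coronaMap f hf φ)).image (fun ψ => (ψ.eval h).re)
    (Complex.continuous_re.comp (HigsonCorona.continuous_eval h)).continuousOn
  -- Connectedness of the fibre would give a point with $\operatorname{Re} h = 1/2$, but $h(h-1) =
  -- 0$ there.
  obtain ⟨ψ, hψ, hψh⟩ := hpre.Icc_subset ⟨φ', heq, rfl⟩ ⟨φ, rfl, rfl⟩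
    (show (1 / 2 : ℝ) ∈ Set.Icc (φ'.eval h).re (φ.eval h).re by
      rw [hφh, hφ'h, Complex.zero_re, Complex.one_re]
      constructor <;> norm_num)
  have hψg : ψ.eval (pullback f hf g) = 1 := by
    rw [← eval_coronaMap, Set.mem_singleton_iff.1 hψ, eval_coronaMap, hφg]
  have hψmul := congrArg ψ.eval hmul
  rw [map_mul, map_sub, hψg, map_zero, mul_eq_zero, sub_eq_zero] at hψmul
  simp only at hψh
  rcases hψmul with e | e
  · rw [e, Complex.zero_re] at hψh
    norm_num at hψh
  · rw [e, Complex.one_re] at hψh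
    norm_num at hψh

end Coarse

theorem mainTheorem3 {X : Type*} {Y : Type*} [MetricSpace X] [ProperSpace X] [Nonempty X]
    [MetricSpace Y] [ProperSpace Y] (f : X → Y)
    (hf : Coarse.IsCoarseMap (Coarse.metricStructure X) (Coarse.metricStructure Y) f) :
    Coarse.IsCoarselyMonotone (Coarse.metricStructure X) (Coarse.metricStructure Y) f ↔
      Coarse.IsMonotoneMap (Coarse.coronaMap f hf) := by
  rw [Coarse.isCoarselyMonotone_iff hf.1]
  constructor
  · rintro ⟨hs, hc⟩
    have hsurj := hs.surjective_coronaMap hf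
    exact ⟨hsurj, fun y => ⟨hsurj y, hc.isPreconnected_fibre hf y⟩⟩
  · rintro ⟨hs, hc⟩
    exact ⟨Coarse.coarselySurjective_of_surjective_coronaMap hf hs,
      Coarse.coarselyConnectedFibres_of_isPreconnected hf fun y => (hc y).isPreconnected⟩
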